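/- **Setting.** Let $\gamma_d=\mathcal N(0,I)$ on $\mathbb R^d$. A halfspace is a function $f(x)=\mathrm{sign}(w\cdot x+t)\in\{\pm1\}$; it is $p$-biased if $\min\{\Pr_{x\sim\gamma_d}[f(x)=1],\Pr_{x\sim\gamma_d}[f(x)=-1]\}=p$. For a halfspace $f$ let $D_f$ be the law of $(x,y)$ with $x\sim\gamma_d$ and, given $x$, $y=f(x)$ with probability $2/3$ and $y=-f(x)$ with probability $1/3$ (random classification noise, $\eta=1/3$). For $u>0$, a $\mathrm{VSTAT}(u)$ oracle for a distribution $D$ answers a query $q:\mathbb R^d\times\{\pm1\}\to[-1,1]$ with any value $v$ such that $|v-\mathbb E_D[q]|\le\max\big(1/u,\sqrt{\mathrm{Var}_D[q]/u}\big)$. A (randomized) statistical query (SQ) algorithm makes finitely many adaptive queries, choosing $q$ and $u$ each time, and then outputs something, with no other access to $D$. It learns $p$-biased Gaussian halfspaces with noise rate $\eta=1/3$ to error below $r$ if for every $p$-biased halfspace $f$ and every valid choice of oracle answers for $D_f$ its output $h:\mathbb R^d\to\{\pm1\}$ satisfies $\Pr_{(x,y)\sim D_f}[h(x)\ne y]<r$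 with probability at least $2/3$ over its own randomness. It solves the testing problem with parameter $p$ if, with probability at least $2/3$ and for all valid oracle answers, it distinguishes the product distribution $D_0$, under which $x\sim\gamma_d$ and $y\in\{\pm1\}$ is independent of $x$ with $\Pr[y=1]=\eta+(1-2\eta)p$, from all the distributions $D_f$ with $f$ a halfspace such that $\Pr_{x\sim\gamma_d}[f(x)=1]=p$. **Theorem 3.2.** There is an absolute constant $k\in\mathbb N$ such that for every $c\in(0,1/2)$ and every $B>0$ there are $A>0$, $\kappa>0$ and $d_0$ such that the following holds for all $d\ge d_0$ and all $p$ with $2^{-Bd^c}\le p\le 1/2$. Put $M=d^{1/2-c}/p^2$. 1. Every SQ algorithm that learns $p$-biased Gaussian halfspaces on $\mathbb R^d$ with noise rate $\eta=1/3$ to error below $\eta+p/3$ either makes, on some input of this problem and for some valid oracle answers, with positive probability a query to $\mathrm{VSTAT}(u)$ with $u\ge A\,M/(\log M)^k$, or makes, on some input and for some valid oracle answers, with positive probability at least $2^{\kappa d^c}$ queries. 2. The same alternative holds for every SQ algorithm that solves the testing problem with parameter $p$. -/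

import Mathlib

open MeasureTheory ProbabilityTheory Filter

noncomputable section

/-! ### The statistical query model -/

/-- A statistical query on `X`: a measurable function with values in `[-1, 1]`. -/
structure StatQuery (X : Type*) [MeasurableSpace X] where
  toFun : X → ℝ
  measurable_toFun : Measurable toFun
  mem_Icc : ∀ x, toFun x ∈ Set.Icc (-1 : ℝ) 1

/-- An oracle receives a query and an accuracy parameter `u > 0`, and returns a real number. -/
abbrev SQOracle (X : Type*) [MeasurableSpace X] : Type _ :=
  StatQuery X → Set.Ioi (0 : ℝ) → ℝ

/-- `O` answers every query `q` with parameter `u` as a `VSTAT(u)` oracle for `D` must, i.e. up to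
the tolerance `max (1/u) √(Var_D[q]/u)`. Within that tolerance the answers are arbitrary. -/
def IsVSTATOracle {X : Type*} [MeasurableSpace X] (D : Measure X) (O : SQOracle X) : Prop :=
  ∀ (q : StatQuery X) (u : Set.Ioi (0 : ℝ)),
    |O q u - ∫ x, q.toFun x ∂D| ≤
      max (1 / (u : ℝ)) (Real.sqrt (Var[q.toFun; D] / (u : ℝ)))

/-- A deterministic adaptive statistical query algorithm: it either stops with an output, or it
sends a query `q` to `VSTAT(u)` and continues in a way that depends on the answer.
There is no restriction on the computation between the queries. -/
inductive SQAlgorithm (X : Type*) [MeasurableSpace X] (Out : Type*) : Type _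
  | output (o : Out) : SQAlgorithm X Out
  | ask (q : StatQuery X) (u : Set.Ioi (0 : ℝ)) (next : ℝ → SQAlgorithm X Out) :
      SQAlgorithm X Out

namespace SQAlgorithm

variable {X : Type*} [MeasurableSpace X] {Out : Type*}

/-- The output of the algorithm when its queries are answered by `O`. -/
def run (O : SQOracle X) : SQAlgorithm X Out → Out
  | output o => o
  | ask q u next => run O (next (O q u))

/-- The list of the parameters `u` of all the queries that the algorithm makes (in the order in
which it makes them) when its queries are answered by `O`. Its length is the number of queries. -/
def params (O : SQOracle X) : SQAlgorithm X Out → List ℝ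
  | output _ => []
  | ask q u next => (u : ℝ) :: params O (next (O q u))

end SQAlgorithm

section Randomized

variable {X : Type*} [MeasurableSpace X] {Out : Type*} {Ω : Type*} [MeasurableSpace Ω]

/-- A randomized algorithm is a family of deterministic algorithms indexed by a random seed
`ω ∼ P`. It solves a problem on the class `𝒟` if, for every `D ∈ 𝒟` and every choice of valid
oracle answers for `D`, the output is good for `D` with probability at least `2/3`. -/
def SolvesOn (P : Measure Ω) (alg : Ω → SQAlgorithm X Out) (𝒟 : Set (Measure X))
    (Good : Measure X → Out → Prop) : Prop :=
  ∀ D ∈ 𝒟, ∀ O : SQOracle X, IsVSTATOracle D O →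
    ∃ S : Set Ω, MeasurableSet S ∧ ENNReal.ofReal (2 / 3) ≤ P S ∧
      ∀ ω ∈ S, Good D ((alg ω).run O)

/-- On some input distribution from `𝒟`, with valid oracle answers, the algorithm makes with
positive probability a query to `VSTAT(u)` for some `u ≥ U`. -/
def UsesAccuracy (P : Measure Ω) (alg : Ω → SQAlgorithm X Out) (𝒟 : Set (Measure X))
    (U : ℝ) : Prop :=
  ∃ D ∈ 𝒟, ∃ O : SQOracle X, IsVSTATOracle D O ∧
    ∃ᵐ ω ∂P, ∃ u ∈ (alg ω).params O, U ≤ u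

/-- On some input distribution from `𝒟`, with valid oracle answers, the algorithm makes with
positive probability at least `N` queries. -/
def MakesQueries (P : Measure Ω) (alg : Ω → SQAlgorithm X Out) (𝒟 : Set (Measure X))
    (N : ℝ) : Prop :=
  ∃ D ∈ 𝒟, ∃ O : SQOracle X, IsVSTATOracle D O ∧
    ∃ᵐ ω ∂P, N ≤ (((alg ω).params O).length : ℝ)

end Randomized

/-! ### Gaussian halfspaces with random classification noise

The labels `+1` and `-1` are represented by `true` and `false`. -/

/-- The space `ℝ^d`, with the Euclidean structure. -/
abbrev Euc (d : ℕ) : Type := EuclideanSpace ℝ (Fin d)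

/-- The halfspaces `x ↦ sign (⟨w, x⟩ + t)` on `ℝ^d`, with `sign 0 = +1`. -/
def IsHalfspace {d : ℕ} (f : Euc d → Bool) : Prop :=
  ∃ (w : Euc d) (t : ℝ), ∀ x, f x = true ↔ 0 ≤ inner ℝ w x + t

/-- `f` is `p`-biased under the standard Gaussian distribution. -/
def IsBiased {d : ℕ} (p : ℝ) (f : Euc d → Bool) : Prop :=
  min ((stdGaussian (Euc d)).real {x | f x = true})
    ((stdGaussian (Euc d)).real {x | f x = false}) = p

/-- The law of `(x, y)` for a standard Gaussian `x`, where `y = f x` with probability `1 - η` and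
`y = - f x` with probability `η`, independently of `x`. -/
def rcnDist {d : ℕ} (η : ℝ) (f : Euc d → Bool) : Measure (Euc d × Bool) :=
  ENNReal.ofReal (1 - η) • (stdGaussian (Euc d)).map (fun x => (x, f x)) +
    ENNReal.ofReal η • (stdGaussian (Euc d)).map (fun x => (x, !f x))

/-- The distributions of the learning problem: `p`-biased Gaussian halfspaces on `ℝ^d` with random
classification noise of rate `η`. -/
def biasedClass (d : ℕ) (η p : ℝ) : Set (Measure (Euc d × Bool)) :=
  {D | ∃ f : Euc d → Bool, IsHalfspace f ∧ IsBiased p f ∧ D = rcnDist η f}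

/-- The hypotheses that a learner may output: measurable functions `ℝ^d → {±1}`. -/
abbrev Hypothesis (d : ℕ) : Type := {h : Euc d → Bool // Measurable h}

/-- The misclassification error `Pr_{(x, y) ∼ D} [h x ≠ y]`. -/
def err {d : ℕ} (D : Measure (Euc d × Bool)) (h : Hypothesis d) : ℝ :=
  D.real {z | h.1 z.1 ≠ z.2}

/-- `alg` learns `p`-biased Gaussian halfspaces with noise rate `η` to error less than `r`. -/
def Learns {d : ℕ} {Ω : Type*} [MeasurableSpace Ω] (P : Measure Ω)
    (alg : Ω → SQAlgorithm (Euc d × Bool) (Hypothesis d)) (η p r : ℝ) : Prop :=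
  SolvesOn P alg (biasedClass d η p) (fun D h => err D h < r)

/-! ### The testing version -/

/-- The alternatives of the testing problem: noisy halfspaces `f` with `Pr [f(x) = +1] = p`. -/
def posClass (d : ℕ) (η p : ℝ) : Set (Measure (Euc d × Bool)) :=
  {D | ∃ f : Euc d → Bool, IsHalfspace f ∧
    (stdGaussian (Euc d)).real {x | f x = true} = p ∧ D = rcnDist η f}

/-- The null distribution: `x` is standard Gaussian and `y` is independent of `x`, with the label
probability `Pr [y = +1] = η + (1 - 2η) p` that all the members of `posClass d η p` have. -/
def nullDist (d : ℕ) (η p : ℝ) : Measure (Euc d × Bool) :=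
  (stdGaussian (Euc d)).prod
    (ENNReal.ofReal (η + (1 - 2 * η) * p) • Measure.dirac true +
      ENNReal.ofReal (1 - (η + (1 - 2 * η) * p)) • Measure.dirac false)

/-- The input distributions of the testing problem. -/
def testClass (d : ℕ) (η p : ℝ) : Set (Measure (Euc d × Bool)) :=
  insert (nullDist d η p) (posClass d η p)

/-- `alg` distinguishes the null distribution (answer `false`) from the members of
`posClass d η p` (answer `true`). -/
def Tests {d : ℕ} {Ω : Type*} [MeasurableSpace Ω] (P : Measure Ω)
    (alg : Ω → SQAlgorithm (Euc d × Bool) Bool) (η p : ℝ) : Prop :=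
  SolvesOn P alg (testClass d η p)
    (fun D b => (D = nullDist d η p → b = false) ∧ (D ∈ posClass d η p → b = true))

/-- `A · M / (log M)^k` for `M = d^(1/2 - c) / p²`: the quantity `d^(1/2 - c) / p²` up to a
polylogarithmic factor in it. -/
def accuracyThreshold (A : ℝ) (k : ℕ) (c : ℝ) (d : ℕ) (p : ℝ) : ℝ :=
  A * ((d : ℝ) ^ (1 / 2 - c) / p ^ 2) / Real.log ((d : ℝ) ^ (1 / 2 - c) / p ^ 2) ^ k

end

noncomputable section

/-! ### Hypercontractivity on the discrete cube -/

/-! The hard instances are the `2 ^ d` halfspaces of measure `p` whose normals are normalized sign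
vectors. For each of them `hidingOracle` answers with the expectation under the null distribution
whenever the tolerance allows. If every query separates only a tiny fraction of these instances from
the null distribution, then by `card_run_ne_le` an algorithm with few queries has the same output on
almost all of them as on the null distribution. A tester is then fooled. A learner commits to one
hypothesis, which cannot be good for both `v` and `-v` (`two_mul_gaussTail_le`), so it succeeds on
barely more than half of the instances.

It remains to bound how many instances one query detects. Only the dependence of the query on the
label matters. Label noise bounds the query's variance below by a multiple of the squared norm of
`labelPart`, so detection at accuracy below `U` forces a squared correlation of order at least `1 /
U` times that norm with the centred indicator of the halfspace. If a set `S` of instances is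
detected with the same sign, Cauchy–Schwarz (`card_sq_mul_le_sum_correlation`) makes the average
covariance over pairs in `S` at least of order `1 / U`.

This average is bounded above in two steps. A two-dimensional Gaussian computation
(`halfspace_covariance_le`) bounds the covariance by `p ^ 2` times a power of `1 + t` times `exp |8
L ρ| - 1`, where `L = log (1 / p)` and `ρ` is the inner product of the normals. Small set expansion
on the cube (`sum_exp_signInner_le`), a consequence of hypercontractivity, bounds the average of
`exp (l ⟨u, v⟩)` over any set of density at least `exp (-X)`. With `X = d ^ c` and `L ≤ B d ^ c` the
averaged excess is of order `L d ^ (c - 1/2)`, and with the `(1 + t) ^ 3` factor this gives the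
threshold `d ^ (1/2 - c) / p ^ 2` up to three logarithms. -/

theorem two_mul_le_rpow_sub_rpow {s y : ℝ} (hs0 : 0 ≤ s) (hs1 : s ≤ 1) (hy0 : 0 ≤ y)
    (hy1 : y ≤ 1) : 2 * s * y ≤ (1 + y) ^ s - (1 - y) ^ s := by
  rcases hs0.eq_or_lt with rfl | hs
  · simp
  have hmono : MonotoneOn (fun x : ℝ => (1 + x) ^ s - (1 - x) ^ s - 2 * s * x)
      (Set.Icc 0 1) := by
    have hd : ∀ x ∈ Set.Ioo (0 : ℝ) 1, HasDerivAt
        (fun x : ℝ => (1 + x) ^ s - (1 - x) ^ s - 2 * s * x)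
        (1 * s * (1 + x) ^ (s - 1) - (-1) * s * (1 - x) ^ (s - 1) - 2 * s * 1) x := by
      intro x hx
      have h1 : HasDerivAt (fun x : ℝ => 1 + x) 1 x := (hasDerivAt_id x).const_add 1
      have h2 : HasDerivAt (fun x : ℝ => 1 - x) (-1) x := (hasDerivAt_id x).const_sub 1
      exact ((h1.rpow_const (Or.inl (by linarith [hx.1]))).sub
        (h2.rpow_const (Or.inl (by linarith [hx.2])))).sub ((hasDerivAt_id x).const_mul (2 * s))
    refine monotoneOn_of_deriv_nonneg (convex_Icc 0 1) ?_ ?_ ?_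
    · refine ((ContinuousOn.rpow_const (by fun_prop) fun x _ => Or.inr hs.le).sub
        (ContinuousOn.rpow_const (by fun_prop) fun x _ => Or.inr hs.le)).sub (by fun_prop)
    · rw [interior_Icc]
      exact fun x hx => (hd x hx).differentiableAt.differentiableWithinAt
    · rw [interior_Icc]
      intro x hx
      rw [(hd x hx).deriv]
      have ha : 0 < (1 + x) ^ (s - 1) := Real.rpow_pos_of_pos (by linarith [hx.1]) _
      have hb : 0 < (1 - x) ^ (s - 1) := Real.rpow_pos_of_pos (by linarith [hx.2]) _
      -- The product is a nonpositive power of `1 - x ^ 2 ≤ 1`. By AM-GM the sum of the two powers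
      -- is then at least `2`, which is the sign of the derivative.
      have hab : 1 ≤ (1 + x) ^ (s - 1) * (1 - x) ^ (s - 1) := by
        rw [← Real.mul_rpow (by linarith [hx.1]) (by linarith [hx.2])]
        apply Real.one_le_rpow_of_pos_of_le_one_of_nonpos
        · nlinarith [hx.1, hx.2]
        · nlinarith [hx.1, hx.2]
        · linarith
      have : 2 ≤ (1 + x) ^ (s - 1) + (1 - x) ^ (s - 1) := by
        nlinarith [sq_nonneg ((1 + x) ^ (s - 1) - (1 - x) ^ (s - 1))]
      nlinarith
  have := hmono (Set.left_mem_Icc.2 zero_le_one) ⟨hy0, hy1⟩ hy0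
  simp at this
  linarith

/-- Both sides agree to second order at `y = 0`, and the derivative of the difference is nonnegative
by the previous inequality with `s = r - 1`. -/
theorem one_add_mul_sq_le_rpow_add_rpow {r y : ℝ} (hr1 : 1 ≤ r) (hr2 : r ≤ 2) (hy0 : 0 ≤ y)
    (hy1 : y ≤ 1) : 1 + r / 2 * ((r - 1) * y ^ 2) ≤ ((1 + y) ^ r + (1 - y) ^ r) / 2 := by
  have hmono : MonotoneOn (fun x : ℝ => (1 + x) ^ r + (1 - x) ^ r - r * (r - 1) * x ^ 2)
      (Set.Icc 0 1) := by
    have hd : ∀ x ∈ Set.Ioo (0 : ℝ) 1, HasDerivAt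
        (fun x : ℝ => (1 + x) ^ r + (1 - x) ^ r - r * (r - 1) * x ^ 2)
        (1 * r * (1 + x) ^ (r - 1) + (-1) * r * (1 - x) ^ (r - 1) -
          r * (r - 1) * (2 * x)) x := by
      intro x hx
      have h1 : HasDerivAt (fun x : ℝ => 1 + x) 1 x := (hasDerivAt_id x).const_add 1
      have h2 : HasDerivAt (fun x : ℝ => 1 - x) (-1) x := (hasDerivAt_id x).const_sub 1
      have h3 : HasDerivAt (fun x : ℝ => x ^ 2) (2 * x) x := by
        simpa using hasDerivAt_pow 2 x
      exact ((h1.rpow_const (Or.inl (by linarith [hx.1]))).add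
        (h2.rpow_const (Or.inl (by linarith [hx.2])))).sub (h3.const_mul _)
    refine monotoneOn_of_deriv_nonneg (convex_Icc 0 1) ?_ ?_ ?_
    · refine ((ContinuousOn.rpow_const (by fun_prop) fun x _ => Or.inr (by linarith)).add
        (ContinuousOn.rpow_const (by fun_prop) fun x _ => Or.inr (by linarith))).sub
          (by fun_prop)
    · rw [interior_Icc]
      exact fun x hx => (hd x hx).differentiableAt.differentiableWithinAt
    · rw [interior_Icc]
      intro x hx
      rw [(hd x hx).deriv]
      have := two_mul_le_rpow_sub_rpow (s := r - 1) (by linarith) (by linarith) hx.1.le hx.2.le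
      nlinarith
  have := hmono (Set.left_mem_Icc.2 zero_le_one) ⟨hy0, hy1⟩ hy0
  simp at this
  linarith

/-- The two-point hypercontractive inequality from `L^(1+ρ)` to `L²`. -/
theorem two_point_sq_le {ρ a b : ℝ} (hρ0 : 0 ≤ ρ) (hρ1 : ρ ≤ 1) (ha : 0 ≤ a) (hb : 0 ≤ b) :
    ((a + b) / 2) ^ 2 + ρ * ((a - b) / 2) ^ 2 ≤
      (((a ^ (1 + ρ) + b ^ (1 + ρ)) / 2) ^ (1 / (1 + ρ))) ^ 2 := by
  wlog hab : b ≤ a generalizing a b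
  · have := this hb ha (le_of_not_ge hab)
    rw [add_comm (b ^ _)] at this
    nlinarith
  rcases ha.eq_or_lt with rfl | ha'
  · have : b = 0 := le_antisymm hab hb
    subst this
    simp only [add_zero, sub_zero, zero_div, ne_eq, OfNat.ofNat_ne_zero, not_false_eq_true,
      zero_pow, mul_zero]
    positivity
  -- By homogeneity the pair `a, b` may be written as `m (1 ± y)` with `0 ≤ y ≤ 1`.
  set m := (a + b) / 2 with hm
  have hm0 : 0 < m := by positivity
  set y := (a - b) / (a + b) with hy
  have hy0 : 0 ≤ y := div_nonneg (by linarith) (by linarith)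
  have hy1 : y ≤ 1 := by rw [hy, div_le_one (by linarith)]; linarith
  have hae : a = m * (1 + y) := by rw [hm, hy]; field_simp; ring
  have hbe : b = m * (1 - y) := by rw [hm, hy]; field_simp; ring
  have hde : (a - b) / 2 = m * y := by rw [hm, hy]; field_simp
  have hr : 0 < 1 + ρ := by linarith
  -- Bernoulli's inequality for the exponent `(1 + ρ) / 2 ≤ 1` linearizes the left side to exactly
  -- the quadratic lower bound just proved for the right side.
  have key : (1 + ρ * y ^ 2) ^ ((1 + ρ) / 2) ≤ ((1 + y) ^ (1 + ρ) + (1 - y) ^ (1 + ρ)) / 2 := by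
    refine (rpow_one_add_le_one_add_mul_self ?_ (by linarith) (by linarith)).trans ?_
    · nlinarith [sq_nonneg y, mul_nonneg hρ0 (sq_nonneg y)]
    · simpa using one_add_mul_sq_le_rpow_add_rpow (r := 1 + ρ) (by linarith) (by linarith) hy0 hy1
  have hA : (a ^ (1 + ρ) + b ^ (1 + ρ)) / 2 =
      m ^ (1 + ρ) * (((1 + y) ^ (1 + ρ) + (1 - y) ^ (1 + ρ)) / 2) := by
    rw [hae, hbe, Real.mul_rpow hm0.le (by linarith), Real.mul_rpow hm0.le (by linarith)]
    ring
  have h1y : 0 ≤ 1 + ρ * y ^ 2 := by positivity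
  have hpos : 0 ≤ ((1 + y) ^ (1 + ρ) + (1 - y) ^ (1 + ρ)) / 2 :=
    (Real.rpow_nonneg h1y _).trans key
  rw [hA, Real.mul_rpow (by positivity) hpos, ← Real.rpow_mul hm0.le, mul_one_div_cancel hr.ne',
    Real.rpow_one, mul_pow, hde]
  have h2 : 1 + ρ * y ^ 2 ≤
      ((((1 + y) ^ (1 + ρ) + (1 - y) ^ (1 + ρ)) / 2) ^ (1 / (1 + ρ))) ^ 2 := by
    have := Real.rpow_le_rpow (Real.rpow_nonneg h1y _) key (z := 2 / (1 + ρ)) (by positivity)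
    rw [← Real.rpow_mul h1y, div_mul_div_comm, mul_comm (1 + ρ) 2, div_self (by positivity),
      Real.rpow_one] at this
    rw [← Real.rpow_mul_natCast hpos]
    convert this using 2
    push_cast
    ring
  nlinarith [sq_nonneg m]

/-- Since `exp (±l) = cosh l * (1 ± tanh l)`, the left side is `4 cosh l` times the product of the
means plus `tanh l` times the product of the half-differences. Cauchy–Schwarz for this form reduces
the claim to `two_point_sq_le` for each factor. It is the one-coordinate case of the cube
inequality. -/
theorem two_point_bilin_le {l a b c e : ℝ} (hl : 0 ≤ l) (ha : 0 ≤ a) (hb : 0 ≤ b) (hc : 0 ≤ c)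
    (he : 0 ≤ e) :
    (a * c + b * e) * Real.exp l + (a * e + b * c) * Real.exp (-l) ≤
      4 * Real.cosh l *
        (((a ^ (1 + Real.tanh l) + b ^ (1 + Real.tanh l)) / 2) ^ (1 / (1 + Real.tanh l)) *
        ((c ^ (1 + Real.tanh l) + e ^ (1 + Real.tanh l)) / 2) ^ (1 / (1 + Real.tanh l))) := by
  have hc0 := Real.cosh_pos l
  have hs0 : 0 ≤ Real.sinh l := Real.sinh_nonneg_iff.2 hl
  have hst : Real.sinh l = Real.cosh l * Real.tanh l := by
    rw [Real.tanh_eq_sinh_div_cosh]; field_simp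
  have hρ0 : 0 ≤ Real.tanh l := by rw [Real.tanh_eq_sinh_div_cosh]; positivity
  have hρ1 : Real.tanh l ≤ 1 := (Real.tanh_lt_one l).le
  set ρ := Real.tanh l
  have h1 := two_point_sq_le hρ0 hρ1 ha hb
  have h2 := two_point_sq_le hρ0 hρ1 hc he
  set X := ((a ^ (1 + ρ) + b ^ (1 + ρ)) / 2) ^ (1 / (1 + ρ))
  set Y := ((c ^ (1 + ρ) + e ^ (1 + ρ)) / 2) ^ (1 / (1 + ρ))
  have hX : 0 ≤ X := by positivity
  have hY : 0 ≤ Y := by positivity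
  have h3 : (a + b) / 2 * ((c + e) / 2) + ρ * ((a - b) / 2 * ((c - e) / 2)) ≤ X * Y := by
    refine le_of_sq_le_sq ?_ (by positivity)
    calc _ ≤ (((a + b) / 2) ^ 2 + ρ * ((a - b) / 2) ^ 2) *
          (((c + e) / 2) ^ 2 + ρ * ((c - e) / 2) ^ 2) := by
          nlinarith [mul_nonneg hρ0 (sq_nonneg ((a + b) / 2 * ((c - e) / 2) -
            (c + e) / 2 * ((a - b) / 2)))]
      _ ≤ X ^ 2 * Y ^ 2 := by gcongr
      _ = (X * Y) ^ 2 := by ring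
  rw [← Real.cosh_add_sinh, ← Real.cosh_sub_sinh, hst]
  nlinarith

/-- The real number `±1` coded by a Boolean. -/
def boolSign (b : Bool) : ℝ := if b then 1 else -1

/-- The inner product of two sign vectors. -/
def signInner {d : ℕ} (u v : Fin d → Bool) : ℝ := ∑ i, boolSign (u i) * boolSign (v i)

/-- The bilinear hypercontractive inequality on the discrete cube. -/
theorem cube_bilin_le {l : ℝ} (hl : 0 ≤ l) (d : ℕ) (f g : (Fin d → Bool) → ℝ)
    (hf : ∀ u, 0 ≤ f u) (hg : ∀ u, 0 ≤ g u) :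
    ∑ u, ∑ v, f u * g v * Real.exp (l * signInner u v) ≤
      (4 * Real.cosh l) ^ d *
        (((∑ u, f u ^ (1 + Real.tanh l)) / 2 ^ d) ^ (1 / (1 + Real.tanh l)) *
        ((∑ u, g u ^ (1 + Real.tanh l)) / 2 ^ d) ^ (1 / (1 + Real.tanh l))) := by
  have hr : 0 < 1 + Real.tanh l := by
    have : 0 ≤ Real.tanh l := by
      rw [Real.tanh_eq_sinh_div_cosh]
      exact div_nonneg (Real.sinh_nonneg_iff.2 hl) (Real.cosh_pos l).le
    linarith
  induction d with
  | zero =>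
    have h1 : ∀ x : ℝ, 0 ≤ x → (x ^ (1 + Real.tanh l)) ^ (1 / (1 + Real.tanh l)) = x := by
      intro x hx
      rw [← Real.rpow_mul hx, mul_one_div_cancel hr.ne', Real.rpow_one]
    simp only [Finset.univ_unique, Finset.sum_singleton, signInner, Finset.univ_eq_empty,
      Finset.sum_empty, mul_zero, Real.exp_zero, mul_one, pow_zero, div_one, one_mul]
    rw [h1 _ (hf _), h1 _ (hg _)]
  | succ d ih =>
    set r := 1 + Real.tanh l with hrdef
    set C := 4 * Real.cosh l with hC
    have hC0 : 0 < C := by have := Real.cosh_pos l; positivity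
    set N : ((Fin d → Bool) → ℝ) → ℝ := fun f => ((∑ u, f u ^ r) / 2 ^ d) ^ (1 / r) with hN
    have hsum : ∀ F : (Fin (d + 1) → Bool) → ℝ, ∑ u, F u =
        ∑ u, F (Fin.cons true u) + ∑ u, F (Fin.cons false u) := by
      intro F
      rw [← (Fin.consEquiv (fun _ : Fin (d + 1) => Bool)).sum_comp F, Fintype.sum_prod_type,
        Fintype.sum_bool]
      rfl
    have hin : ∀ (a b : Bool) (u v : Fin d → Bool),
        signInner (Fin.cons a u : Fin (d + 1) → Bool) (Fin.cons b v : Fin (d + 1) → Bool) =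
          boolSign a * boolSign b + signInner u v := by
      intro a b u v
      simp [signInner, Fin.sum_univ_succ]
    have hNn : ∀ (f : (Fin d → Bool) → ℝ), (∀ u, 0 ≤ f u) → 0 ≤ N f := fun f hf =>
      Real.rpow_nonneg (div_nonneg (Finset.sum_nonneg fun u _ => Real.rpow_nonneg (hf u) _)
        (by positivity)) _
    have hNr : ∀ (f : (Fin (d + 1) → Bool) → ℝ), (∀ u, 0 ≤ f u) →
        ((∑ u, f u ^ r) / 2 ^ (d + 1)) ^ (1 / r) =
        ((N (fun u => f (Fin.cons true u)) ^ r + N (fun u => f (Fin.cons false u)) ^ r) / 2) ^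
          (1 / r) := by
      intro f hf
      simp only [hN]
      rw [hsum, ← Real.rpow_mul, ← Real.rpow_mul, one_div_mul_cancel hr.ne', Real.rpow_one,
        Real.rpow_one]
      · congr 1
        rw [pow_succ]
        field_simp
      all_goals
        exact div_nonneg (Finset.sum_nonneg fun u _ => Real.rpow_nonneg (hf _) _)
          (by positivity)
    rw [hNr f hf, hNr g hg]
    have hpart : ∀ a b : Bool, ∑ u : Fin d → Bool, ∑ v : Fin d → Bool,
        f (Fin.cons a u) * g (Fin.cons b v) * Real.exp (l * signInner
          (Fin.cons a u : Fin (d + 1) → Bool) (Fin.cons b v : Fin (d + 1) → Bool)) ≤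
        Real.exp (l * (boolSign a * boolSign b)) *
          (C ^ d * (N (fun u => f (Fin.cons a u)) * N (fun u => g (Fin.cons b u)))) := by
      intro a b
      refine le_trans (le_of_eq ?_) (mul_le_mul_of_nonneg_left
        (ih (fun u => f (Fin.cons a u)) (fun u => g (Fin.cons b u)) (fun _ => hf _)
          fun _ => hg _) (Real.exp_pos _).le)
      rw [Finset.mul_sum]
      refine Finset.sum_congr rfl fun u _ => ?_
      rw [Finset.mul_sum]
      refine Finset.sum_congr rfl fun v _ => ?_
      rw [hin, mul_add, Real.exp_add]
      ring
    rw [hsum]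
    simp_rw [hsum, Finset.sum_add_distrib]
    have htt := hpart true true
    have htf := hpart true false
    have hft := hpart false true
    have hff := hpart false false
    simp only [boolSign, if_true, Bool.false_eq_true, if_false, mul_one, mul_neg,
      neg_neg] at htt htf hft hff
    -- Tensorization: the induction hypothesis replaced each slice by its norm, and the two-point
    -- inequality now combines the norms of the two slices in the first coordinate.
    have h2 := two_point_bilin_le hl (hNn (fun u => f (Fin.cons true u)) fun _ => hf _)
      (hNn (fun u => f (Fin.cons false u)) fun _ => hf _)
      (hNn (fun u => g (Fin.cons true u)) fun _ => hg _)
      (hNn (fun u => g (Fin.cons false u)) fun _ => hg _)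
    have h3 := mul_le_mul_of_nonneg_left h2 (pow_nonneg hC0.le d)
    rw [← hrdef, ← hC] at h3
    rw [pow_succ]
    linarith


/-! ### Small set expansion on the cube -/

/-- The quotient equals `(1 - exp (-2 l)) / 2`. It measures by how much the hypercontractive
exponent `1 / (1 + tanh l)` falls short of `1`. -/
theorem tanh_div_one_add_tanh_le {l : ℝ} : Real.tanh l / (1 + Real.tanh l) ≤ l := by
  have h1 : Real.exp l ≠ 0 := (Real.exp_pos l).ne'
  have h2 := Real.cosh_pos l
  have : Real.tanh l / (1 + Real.tanh l) = (1 - Real.exp (-(2 * l))) / 2 := by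
    have h3 : 1 + Real.tanh l = Real.exp l / Real.cosh l := by
      rw [Real.tanh_eq_sinh_div_cosh, ← Real.cosh_add_sinh]
      field_simp
    rw [h3, Real.tanh_eq_sinh_div_cosh, div_div_div_cancel_right₀ h2.ne', Real.sinh_eq,
      div_eq_div_iff h1 two_ne_zero, sub_mul, ← Real.exp_add, one_mul]
    ring_nf
  rw [this]
  have := Real.add_one_le_exp (-(2 * l))
  linarith

/-- Small set expansion: two subsets of the cube of the same density are nearly uncorrelated. -/
theorem sum_exp_signInner_le {l : ℝ} (hl : 0 ≤ l) {d : ℕ} {S T : Finset (Fin d → Bool)}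
    (hST : T.card = S.card) (hS : S.Nonempty) :
    ∑ u ∈ S, ∑ v ∈ T, Real.exp (l * signInner u v) ≤
      (S.card : ℝ) ^ 2 * Real.exp (d * l ^ 2 / 2 + 2 * l * Real.log (2 ^ d / S.card)) := by
  have hcard : 0 < (S.card : ℝ) := by exact_mod_cast hS.card_pos
  have hcard2 : (S.card : ℝ) ≤ 2 ^ d := by
    have := S.card_le_univ
    simp only [Fintype.card_pi, Fintype.card_bool, Finset.prod_const, Finset.card_univ,
      Fintype.card_fin] at this
    exact_mod_cast this
  have hρ0 : 0 ≤ Real.tanh l := by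
    rw [Real.tanh_eq_sinh_div_cosh]
    exact div_nonneg (Real.sinh_nonneg_iff.2 hl) (Real.cosh_pos l).le
  have hr : 0 < 1 + Real.tanh l := by linarith
  have hsum : ∀ A : Finset (Fin d → Bool),
      ∑ u, (if u ∈ A then (1 : ℝ) else 0) ^ (1 + Real.tanh l) = A.card := by
    intro A
    rw [Finset.card_eq_sum_ones, Nat.cast_sum, ← Finset.sum_filter_add_sum_filter_not
      Finset.univ (· ∈ A)]
    rw [Finset.sum_congr rfl (g := fun _ => (1 : ℝ)) (by
        intro u hu
        simp only [Finset.mem_filter] at hu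
        simp [hu.2]),
      Finset.sum_congr (s₁ := Finset.univ.filter (· ∉ A)) rfl (g := fun _ => (0 : ℝ)) (by
        intro u hu
        simp only [Finset.mem_filter] at hu
        simp [hu.2, Real.zero_rpow hr.ne'])]
    simp
  have h := cube_bilin_le hl d (fun u => if u ∈ S then 1 else 0) (fun u => if u ∈ T then 1 else 0)
    (fun u => by split_ifs <;> norm_num)
    (fun u => by split_ifs <;> norm_num)
  rw [hsum, hsum, hST] at h
  have hL : ∑ u, ∑ v, (if u ∈ S then (1 : ℝ) else 0) * (if v ∈ T then (1 : ℝ) else 0) *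
      Real.exp (l * signInner u v) = ∑ u ∈ S, ∑ v ∈ T, Real.exp (l * signInner u v) := by
    simp [Finset.sum_ite_mem]
  rw [hL] at h
  refine h.trans ?_
  set m := (S.card : ℝ) / 2 ^ d with hm
  have hm0 : 0 < m := by positivity
  have hm1 : m ≤ 1 := by rw [hm, div_le_one (by positivity)]; exact hcard2
  have hlog : Real.log (2 ^ d / S.card) = - Real.log m := by
    rw [← Real.log_inv, hm, inv_div]
  have hlm : Real.log m ≤ 0 := Real.log_nonpos hm0.le hm1
  have hcosh : Real.cosh l ^ d ≤ Real.exp (d * l ^ 2 / 2) := by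
    calc Real.cosh l ^ d ≤ Real.exp (l ^ 2 / 2) ^ d :=
          pow_le_pow_left₀ (Real.cosh_pos l).le (Real.cosh_le_exp_half_sq l) d
      _ = _ := by rw [← Real.exp_nat_mul]; ring_nf
  -- The total exponent is at least `2 - 2 l` and the density `m` is at most `1`, so the loss
  -- against `m ^ 2` is at most `m ^ (-2 l)`.
  have hpow : m ^ (1 / (1 + Real.tanh l)) * m ^ (1 / (1 + Real.tanh l)) ≤
      m ^ 2 * Real.exp (2 * l * -Real.log m) := by
    rw [← Real.rpow_add hm0, ← Real.rpow_natCast, Real.rpow_def_of_pos hm0,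
      Real.rpow_def_of_pos hm0, ← Real.exp_add, Real.exp_le_exp]
    have h1 : 1 / (1 + Real.tanh l) = 1 - Real.tanh l / (1 + Real.tanh l) := by
      field_simp
      ring
    have h2 := tanh_div_one_add_tanh_le (l := l)
    rw [h1]
    push_cast
    nlinarith
  calc (4 * Real.cosh l) ^ d * (m ^ (1 / (1 + Real.tanh l)) * m ^ (1 / (1 + Real.tanh l)))
      ≤ (4 ^ d * Real.exp (d * l ^ 2 / 2)) * (m ^ 2 * Real.exp (2 * l * -Real.log m)) := by
        rw [mul_pow]
        gcongr
    _ = _ := by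
        rw [hlog, Real.exp_add, hm, div_pow, ← pow_mul, mul_comm d 2, pow_mul]
        norm_num
        field_simp

theorem signInner_not_right {d : ℕ} (u v : Fin d → Bool) :
    signInner u (fun i => !v i) = -signInner u v := by
  simp only [signInner, ← Finset.sum_neg_distrib]
  refine Finset.sum_congr rfl fun i _ => ?_
  cases v i <;> simp [boolSign]

/-- Flipping all coordinates of the second vector changes the sign of the inner product. This is why
small set expansion was proved for two different sets of equal size. -/
theorem sum_exp_neg_signInner_le {l : ℝ} (hl : 0 ≤ l) {d : ℕ} {S : Finset (Fin d → Bool)}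
    (hS : S.Nonempty) :
    ∑ u ∈ S, ∑ v ∈ S, Real.exp (-(l * signInner u v)) ≤
      (S.card : ℝ) ^ 2 * Real.exp (d * l ^ 2 / 2 + 2 * l * Real.log (2 ^ d / S.card)) := by
  classical
  have hinj : Function.Injective (fun (v : Fin d → Bool) (i : Fin d) => !v i) := by
    intro v w h
    funext i
    simpa using congrFun h i
  have h := sum_exp_signInner_le hl (Finset.card_image_of_injective S hinj) hS
  refine le_trans (le_of_eq ?_) h
  refine Finset.sum_congr rfl fun u _ => ?_
  rw [Finset.sum_image hinj.injOn]
  refine Finset.sum_congr rfl fun v _ => ?_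
  rw [signInner_not_right]
  ring_nf

/-- Equivalent to `1 - |x| ≤ exp (-|x|)`. The bracket on the right is controlled on average by the
two signed exponential sums, and the linear term by Cauchy–Schwarz. -/
theorem exp_abs_sub_one_le (x : ℝ) :
    Real.exp |x| - 1 ≤ |x| + (Real.exp x + Real.exp (-x) - 2) := by
  rcases abs_cases x with ⟨h, _⟩ | ⟨h, _⟩ <;> rw [h]
  · linarith [Real.add_one_le_exp (-x)]
  · linarith [Real.add_one_le_exp x]

/-- The right side is `4 sinh (x / 2) ^ 2`. -/
theorem sq_le_exp_add_exp_neg (x : ℝ) : x ^ 2 ≤ Real.exp x + Real.exp (-x) - 2 := by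
  have h1 : |x / 2| ≤ |Real.sinh (x / 2)| := by
    rw [Real.abs_sinh]
    exact Real.self_le_sinh_iff.2 (abs_nonneg _)
  have h2 := sq_le_sq' (by linarith [abs_nonneg (x / 2), abs_nonneg (Real.sinh (x / 2))]) h1
  rw [sq_abs, sq_abs, Real.sinh_sq] at h2
  have h3 := Real.cosh_two_mul (x / 2)
  rw [Real.sinh_sq, mul_div_cancel₀ x two_ne_zero, Real.cosh_eq] at h3
  nlinarith

/-- The average of `exp |l ⟨u, v⟩| - 1` over a set of not too small density is small. -/
theorem sum_exp_abs_signInner_le {l : ℝ} (hl : 0 ≤ l) {d : ℕ} {S : Finset (Fin d → Bool)}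
    (hS : S.Nonempty) {δ : ℝ}
    (hδ : Real.exp (d * l ^ 2 / 2 + 2 * l * Real.log (2 ^ d / S.card)) - 1 ≤ δ) :
    ∑ u ∈ S, ∑ v ∈ S, (Real.exp |l * signInner u v| - 1) ≤
      (S.card : ℝ) ^ 2 * (Real.sqrt (2 * δ) + 2 * δ) := by
  have h1 := sum_exp_signInner_le hl (T := S) rfl hS
  have h2 := sum_exp_neg_signInner_le hl hS
  rw [← Finset.sum_product'] at h1 h2 ⊢
  set P := S ×ˢ S
  have hP : (P.card : ℝ) = (S.card : ℝ) ^ 2 := by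
    rw [Finset.card_product]; push_cast; ring
  have hc : 0 < (S.card : ℝ) ^ 2 := by
    have : 0 < (S.card : ℝ) := by exact_mod_cast hS.card_pos
    positivity
  set x : (Fin d → Bool) × (Fin d → Bool) → ℝ := fun z => l * signInner z.1 z.2 with hx
  have h3 : ∑ z ∈ P, (Real.exp (x z) + Real.exp (-x z) - 2) ≤ (S.card : ℝ) ^ 2 * (2 * δ) := by
    rw [Finset.sum_sub_distrib, Finset.sum_add_distrib, Finset.sum_const, nsmul_eq_mul, hP]
    nlinarith
  have h4 : ∑ z ∈ P, |x z| ≤ (S.card : ℝ) ^ 2 * Real.sqrt (2 * δ) := by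
    -- The first moment is bounded through the second, which produces the square root of `δ` in the
    -- conclusion.
    have h5 : (∑ z ∈ P, |x z|) ^ 2 ≤ ((S.card : ℝ) ^ 2) ^ 2 * (2 * δ) := by
      calc (∑ z ∈ P, |x z|) ^ 2 ≤ P.card * ∑ z ∈ P, |x z| ^ 2 := sq_sum_le_card_mul_sum_sq
        _ ≤ P.card * ∑ z ∈ P, (Real.exp (x z) + Real.exp (-x z) - 2) := by
            gcongr with z _
            rw [sq_abs]
            exact sq_le_exp_add_exp_neg _
        _ ≤ (S.card : ℝ) ^ 2 * ((S.card : ℝ) ^ 2 * (2 * δ)) := by rw [hP]; gcongr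
        _ = _ := by ring
    calc ∑ z ∈ P, |x z| = Real.sqrt ((∑ z ∈ P, |x z|) ^ 2) :=
          (Real.sqrt_sq (Finset.sum_nonneg fun _ _ => abs_nonneg _)).symm
      _ ≤ Real.sqrt (((S.card : ℝ) ^ 2) ^ 2 * (2 * δ)) := Real.sqrt_le_sqrt h5
      _ = _ := by rw [Real.sqrt_mul (by positivity), Real.sqrt_sq hc.le]
  calc ∑ z ∈ P, (Real.exp |x z| - 1) ≤ ∑ z ∈ P, (|x z| + (Real.exp (x z) + Real.exp (-x z) - 2)) :=
        Finset.sum_le_sum fun z _ => exp_abs_sub_one_le _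
    _ ≤ _ := by rw [Finset.sum_add_distrib]; linarith

/-! ### Tails of the standard Gaussian distribution -/

/-- The upper tail of the standard Gaussian distribution on the line. -/
def gaussTail (t : ℝ) : ℝ := (gaussianReal 0 1).real (Set.Ici t)

theorem gaussTail_nonneg (t : ℝ) : 0 ≤ gaussTail t := measureReal_nonneg

theorem gaussTail_anti : Antitone gaussTail := fun _ _ h =>
  measureReal_mono (Set.Ici_subset_Ici.2 h)

theorem gaussianPDFReal_std (y : ℝ) :
    gaussianPDFReal 0 1 y = (Real.sqrt (2 * Real.pi))⁻¹ * Real.exp (-(y ^ 2 / 2)) := by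
  simp [gaussianPDFReal, neg_div]

theorem one_le_sqrt_two_pi : 1 ≤ Real.sqrt (2 * Real.pi) := by
  rw [Real.one_le_sqrt]
  linarith [Real.pi_gt_three]

theorem gaussianPDFReal_std_le (y : ℝ) : gaussianPDFReal 0 1 y ≤ Real.exp (-(y ^ 2 / 2)) := by
  rw [gaussianPDFReal_std]
  exact mul_le_of_le_one_left (Real.exp_pos _).le (inv_le_one_of_one_le₀ one_le_sqrt_two_pi)

theorem gaussianReal_real_eq_integral (s : Set ℝ) :
    (gaussianReal 0 1).real s = ∫ x in s, gaussianPDFReal 0 1 x := by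
  rw [measureReal_def, gaussianReal_apply_eq_integral _ one_ne_zero, ENNReal.toReal_ofReal]
  exact integral_nonneg (gaussianPDFReal_nonneg _ _)

theorem gaussianReal_Ico_le {a b C : ℝ} (hab : a ≤ b)
    (hC : ∀ y ∈ Set.Ico a b, gaussianPDFReal 0 1 y ≤ C) :
    (gaussianReal 0 1).real (Set.Ico a b) ≤ (b - a) * C := by
  rw [gaussianReal_real_eq_integral]
  refine (setIntegral_mono_on (integrable_gaussianPDFReal _ _).integrableOn
    (by simp) measurableSet_Ico hC).trans ?_
  simp [hab]

theorem le_gaussianReal_Ico {a b C : ℝ} (hab : a ≤ b)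
    (hC : ∀ y ∈ Set.Ico a b, C ≤ gaussianPDFReal 0 1 y) :
    (b - a) * C ≤ (gaussianReal 0 1).real (Set.Ico a b) := by
  rw [gaussianReal_real_eq_integral]
  refine le_trans ?_ (setIntegral_mono_on (by simp)
    (integrable_gaussianPDFReal _ _).integrableOn measurableSet_Ico hC)
  simp [hab]

theorem gaussTail_sub_gaussTail {a b : ℝ} (hab : a ≤ b) :
    gaussTail a - gaussTail b = (gaussianReal 0 1).real (Set.Ico a b) := by
  have hdisj : Disjoint (Set.Ico a b) (Set.Ici b) :=
    Set.disjoint_left.2 fun x hx hx' => not_le_of_gt hx.2 hx'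
  rw [gaussTail, gaussTail, ← Set.Ico_union_Ici_eq_Ici hab,
    measureReal_union hdisj measurableSet_Ici]
  ring

theorem continuous_gaussTail : Continuous gaussTail := by
  refine LipschitzWith.continuous (K := 1) (LipschitzWith.of_dist_le_mul fun a b => ?_)
  wlog hab : a ≤ b generalizing a b
  · rw [dist_comm, dist_comm a]
    exact this b a (le_of_not_ge hab)
  rw [Real.dist_eq, Real.dist_eq, abs_of_nonneg (sub_nonneg.2 (gaussTail_anti hab)),
    gaussTail_sub_gaussTail hab, abs_sub_comm, abs_of_nonneg (sub_nonneg.2 hab)]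
  refine (gaussianReal_Ico_le (C := 1) hab fun y _ => (gaussianPDFReal_std_le y).trans ?_).trans
    (by simp)
  rw [Real.exp_le_one_iff]
  nlinarith [sq_nonneg y]

theorem gaussTail_zero : gaussTail 0 = 1 / 2 := by
  have h1 : gaussTail 0 = (gaussianReal 0 1).real (Set.Iio 0) := by
    have h := gaussianReal_map_neg (μ := 0) (v := 1)
    rw [neg_zero] at h
    have : NullSingletonClass (gaussianReal 0 1) := nullSingletonClass_gaussianReal one_ne_zero
    have h2 : (fun x : ℝ => -x) ⁻¹' Set.Ici 0 = Set.Iic 0 := by ext; simp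
    rw [gaussTail, measureReal_congr Iio_ae_eq_Iic]
    conv_lhs => rw [← h]
    rw [map_measureReal_apply (by fun_prop) measurableSet_Ici, h2]
  have h2 := probReal_add_probReal_compl (μ := gaussianReal 0 1) (measurableSet_Ici (a := (0 : ℝ)))
  rw [Set.compl_Ici, ← h1] at h2
  rw [gaussTail] at *
  linarith

theorem integral_exp_mul_gaussianReal_std (a : ℝ) :
    ∫ x, Real.exp (a * x) ∂(gaussianReal 0 1) = Real.exp (a ^ 2 / 2) := by
  have := congrFun (mgf_fun_id_gaussianReal (μ := 0) (v := 1)) a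
  simpa [mgf] using this

/-- Chernoff bound: the indicator of `[t, ∞)` is at most `exp (t x - t ^ 2)`. -/
theorem gaussTail_le_exp {t : ℝ} (ht : 0 ≤ t) : gaussTail t ≤ Real.exp (-(t ^ 2 / 2)) := by
  have h : gaussTail t ≤ ∫ x, Real.exp (-t ^ 2) * Real.exp (t * x) ∂(gaussianReal 0 1) := by
    rw [gaussTail, ← integral_indicator_one measurableSet_Ici]
    refine integral_mono ((integrable_const 1).indicator measurableSet_Ici)
      ((integrable_exp_mul_gaussianReal t).const_mul _) fun x => ?_
    by_cases hx : x ∈ Set.Ici t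
    · rw [Set.indicator_of_mem hx, ← Real.exp_add, Pi.one_apply, Real.one_le_exp_iff]
      have : t ≤ x := hx
      nlinarith
    · rw [Set.indicator_of_notMem hx]
      positivity
  rw [integral_const_mul, integral_exp_mul_gaussianReal_std, ← Real.exp_add] at h
  refine h.trans (le_of_eq ?_)
  ring_nf

theorem exists_gaussTail_eq {p : ℝ} (hp0 : 0 < p) (hp : p ≤ 1 / 2) :
    ∃ t, 0 ≤ t ∧ gaussTail t = p := by
  have hlim : Tendsto (fun t : ℝ => Real.exp (-(t ^ 2 / 2))) atTop (nhds 0) :=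
    Real.tendsto_exp_neg_atTop_nhds_zero.comp
      ((tendsto_pow_atTop two_ne_zero).atTop_div_const two_pos)
  obtain ⟨T, hT, hT0⟩ := ((hlim.eventually (gt_mem_nhds hp0)).and (eventually_ge_atTop 0)).exists
  have h := intermediate_value_Icc' hT0 continuous_gaussTail.continuousOn
  obtain ⟨t, ht, htp⟩ := h ⟨(gaussTail_le_exp hT0).trans hT.le, by rw [gaussTail_zero]; exact hp⟩
  exact ⟨t, ht.1, htp⟩

/-- The constant in the lower bound for Gaussian tails. -/
def millsConst : ℝ := Real.sqrt (2 * Real.pi) * Real.exp (3 / 2)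

theorem one_le_millsConst : 1 ≤ millsConst :=
  one_le_mul_of_one_le_of_one_le one_le_sqrt_two_pi (Real.one_le_exp (by norm_num))

/-- On a window of length `1 / (1 + t)` to the right of `t` the density drops by a factor of at most
`exp (3 / 2)`, so this window alone carries enough mass. -/
theorem exp_le_gaussTail {t : ℝ} (ht : 0 ≤ t) :
    Real.exp (-(t ^ 2 / 2)) ≤ millsConst * (1 + t) * gaussTail t := by
  have ht1 : 0 < 1 + t := by linarith
  have hs := one_le_sqrt_two_pi
  set l := 1 / (1 + t) with hl
  have hl0 : 0 < l := by positivity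
  have hl1 : l ≤ 1 := by rw [hl, div_le_one ht1]; linarith
  have htl : t * l ≤ 1 := by rw [hl, mul_one_div, div_le_one ht1]; linarith
  have h1 : (t + l - t) * ((Real.sqrt (2 * Real.pi))⁻¹ * Real.exp (-(t ^ 2 / 2) - 3 / 2)) ≤
      gaussTail t := by
    refine (le_gaussianReal_Ico (by linarith) fun y hy => ?_).trans
      (measureReal_mono Set.Ico_subset_Ici_self)
    rw [gaussianPDFReal_std]
    gcongr
    have h1 : y ≤ t + l := hy.2.le
    have h2 : t ≤ y := hy.1
    nlinarith
  rw [add_sub_cancel_left, Real.exp_sub] at h1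
  have h2 : Real.exp (-(t ^ 2 / 2)) = millsConst * (1 + t) *
      (l * ((Real.sqrt (2 * Real.pi))⁻¹ * (Real.exp (-(t ^ 2 / 2)) / Real.exp (3 / 2)))) := by
    rw [millsConst, hl]
    field_simp
  rw [h2]
  have := one_le_millsConst
  gcongr

theorem gaussTail_pos {t : ℝ} (ht : 0 ≤ t) : 0 < gaussTail t := by
  have h := exp_le_gaussTail ht
  have h1 : 0 < millsConst * (1 + t) := mul_pos (by linarith [one_le_millsConst]) (by linarith)
  by_contra hn
  have : gaussTail t = 0 := le_antisymm (not_lt.1 hn) (gaussTail_nonneg t)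
  rw [this, mul_zero] at h
  exact absurd h (not_le.2 (Real.exp_pos _))

theorem gaussTail_sub_le {t δ : ℝ} (ht : 0 ≤ t) (hδ : 0 ≤ δ) :
    gaussTail (t - δ) - gaussTail t ≤ δ * (Real.exp (-(t ^ 2 / 2)) * Real.exp (t * δ)) := by
  rw [gaussTail_sub_gaussTail (by linarith)]
  have h : (gaussianReal 0 1).real (Set.Ico (t - δ) t) ≤
      (t - (t - δ)) * (Real.exp (-(t ^ 2 / 2)) * Real.exp (t * δ)) := by
    refine gaussianReal_Ico_le (by linarith) fun y hy => (gaussianPDFReal_std_le y).trans ?_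
    rw [← Real.exp_add, Real.exp_le_exp]
    nlinarith [sq_nonneg (t - y), hy.1, mul_nonneg ht (sub_nonneg.2 hy.1)]
  simpa using h

/-! ### Two-dimensional marginals -/

section Marginals

variable {E : Type*} [NormedAddCommGroup E] [InnerProductSpace ℝ E] [FiniteDimensional ℝ E]
  [MeasurableSpace E] [BorelSpace E]

theorem stdGaussian_map_inner {u : E} (hu : ‖u‖ = 1) :
    (stdGaussian E).map (fun x => inner ℝ u x) = gaussianReal 0 1 := by
  have h := IsGaussian.map_eq_gaussianReal (μ := stdGaussian E) (innerSL ℝ u)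
  rw [integral_strongDual_stdGaussian, variance_dual_stdGaussian, innerSL_apply_norm, hu] at h
  simpa using h

theorem stdGaussian_real_halfspace {u : E} (hu : ‖u‖ = 1) (t : ℝ) :
    (stdGaussian E).real {x | t ≤ inner ℝ u x} = gaussTail t := by
  rw [gaussTail, ← stdGaussian_map_inner hu, map_measureReal_apply (by fun_prop) measurableSet_Ici]
  rfl

theorem stdGaussian_map_inner_prod {u w : E} (hu : ‖u‖ = 1) (hw : ‖w‖ = 1)
    (huw : inner ℝ u w = 0) :
    (stdGaussian E).map (fun x => (inner ℝ u x, inner ℝ w x)) =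
      (gaussianReal 0 1).prod (gaussianReal 0 1) := by
  have hlaw : HasGaussianLaw (fun x : E => (inner ℝ u x, inner ℝ w x)) (stdGaussian E) :=
    HasGaussianLaw.map (X := id) IsGaussian.hasGaussianLaw_id ((innerSL ℝ u).prod (innerSL ℝ w))
  have hind := hlaw.indepFun_of_covariance_eq_zero (by
    rw [← covarianceBilin_apply_eq_cov IsGaussian.memLp_two_id, covarianceBilin_stdGaussian]
    exact huw)
  rw [(indepFun_iff_map_prod_eq_prod_map_map (by fun_prop) (by fun_prop)).1 hind,
    stdGaussian_map_inner hu, stdGaussian_map_inner hw]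

/-- Gram–Schmidt writes `v = ρ u + s w` with `w` a unit vector orthogonal to `u`. The coordinates
along `u` and `w` are independent, and Fubini integrates out the one along `w`. -/
theorem stdGaussian_real_inter_halfspace_eq {u v : E} (hu : ‖u‖ = 1) (hv : ‖v‖ = 1) {s : ℝ}
    (hs : 0 < s) (hs2 : s ^ 2 = 1 - (inner ℝ u v : ℝ) ^ 2) (t : ℝ) :
    (stdGaussian E).real {x | t ≤ inner ℝ u x ∧ t ≤ inner ℝ v x} =
      ∫ x in Set.Ici t, gaussTail ((t - inner ℝ u v * x) / s) ∂(gaussianReal 0 1) := by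
  set ρ : ℝ := inner ℝ u v with hρ
  set w : E := s⁻¹ • (v - ρ • u) with hw
  have huw : inner ℝ u w = 0 := by
    rw [hw, inner_smul_right, inner_sub_right, inner_smul_right, real_inner_self_eq_norm_sq, hu,
      ← hρ]
    ring
  have hwn : ‖w‖ = 1 := by
    have h1 : ‖v - ρ • u‖ ^ 2 = s ^ 2 := by
      rw [norm_sub_sq_real, inner_smul_right, norm_smul, hu, hv, real_inner_comm, ← hρ, hs2,
        Real.norm_eq_abs, mul_one, sq_abs]
      ring
    have h2 : ‖v - ρ • u‖ = s := (pow_left_inj₀ (norm_nonneg _) hs.le two_ne_zero).1 h1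
    rw [hw, norm_smul, h2, Real.norm_eq_abs, abs_of_pos (inv_pos.2 hs), inv_mul_cancel₀ hs.ne']
  have hvx : ∀ x : E, (inner ℝ v x : ℝ) = ρ * inner ℝ u x + s * inner ℝ w x := by
    intro x
    rw [hw, inner_smul_left, inner_sub_left, inner_smul_left]
    simp only [conj_trivial]
    field_simp
    ring
  set A : Set (ℝ × ℝ) := {z | t ≤ z.1 ∧ t ≤ ρ * z.1 + s * z.2} with hA
  have hAm : MeasurableSet A := by
    have h1 : MeasurableSet {z : ℝ × ℝ | t ≤ z.1} := measurableSet_le (by fun_prop) (by fun_prop)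
    have h2 : MeasurableSet {z : ℝ × ℝ | t ≤ ρ * z.1 + s * z.2} :=
      measurableSet_le (by fun_prop) (by fun_prop)
    exact h1.inter h2
  have h1 : (stdGaussian E).real {x | t ≤ inner ℝ u x ∧ t ≤ inner ℝ v x} =
      ((gaussianReal 0 1).prod (gaussianReal 0 1)).real A := by
    rw [← stdGaussian_map_inner_prod hu hwn huw, map_measureReal_apply (by fun_prop) hAm]
    congr 1
    ext x
    simp [hA, hvx]
  rw [h1, measureReal_def, Measure.prod_apply hAm,
    ← integral_toReal (measurable_measure_prodMk_left hAm).aemeasurable (by simp [measure_lt_top]),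
    ← integral_indicator measurableSet_Ici]
  congr 1
  funext x
  by_cases hx : x ∈ Set.Ici t
  · rw [Set.indicator_of_mem hx, gaussTail, measureReal_def]
    congr 2
    ext z
    have hx' : t ≤ x := hx
    simp only [hA, Set.mem_preimage, Set.mem_ofPred_eq, hx', true_and, Set.mem_Ici,
      div_le_iff₀ hs]
    constructor <;> intro h <;> linarith
  · rw [Set.indicator_of_notMem hx]
    have hx' : ¬ t ≤ x := hx
    simp [hA, hx']

/-- The pointwise bound has an exponential form in `x` so that it can be integrated over the whole
line in closed form. For `ρ ≤ 0` conditioning only raises the threshold, whence `max ρ 0`. -/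
theorem gaussTail_div_sub_le {t ρ s x : ℝ} (ht : 0 ≤ t) (htx : t ≤ x) (hρ : ρ ≤ 1 / 2)
    (hs : 0 < s) (hs2 : s ^ 2 = 1 - ρ ^ 2) (hρ' : -(1 / 2) ≤ ρ) :
    gaussTail ((t - ρ * x) / s) - gaussTail t ≤
      2 * max ρ 0 * Real.exp (-(t ^ 2 / 2)) * ((1 + t) * (Real.exp (2 * t ^ 2 * max ρ 0 - t ^ 2) *
        Real.exp ((t + 1 / (1 + t)) * x))) := by
  have hs1 : s ≤ 1 := by nlinarith
  have hs12 : 1 / 2 ≤ s := by nlinarith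
  have hx : 0 ≤ x := ht.trans htx
  rcases le_total ρ 0 with hρ0 | hρ0
  · rw [max_eq_right hρ0]
    have : t ≤ (t - ρ * x) / s := by
      rw [le_div_iff₀ hs]
      nlinarith
    have := gaussTail_anti this
    simp only [mul_zero, zero_mul]
    linarith
  rw [max_eq_left hρ0]
  -- If the left side is nonnegative, `s ≤ 1` suffices; if it is negative, `1 / 2 ≤ s` does.
  have h1 : t - 2 * ρ * x ≤ (t - ρ * x) / s := by
    rw [le_div_iff₀ hs]
    have hρx := mul_nonneg hρ0 hx
    rcases le_total 0 (t - 2 * ρ * x) with h | h <;> nlinarith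
  have h2 := gaussTail_sub_le (δ := 2 * ρ * x) ht (by positivity)
  have h3 : x * Real.exp (t * (2 * ρ * x)) ≤ (1 + t) * (Real.exp (2 * t ^ 2 * ρ - t ^ 2) *
        Real.exp ((t + 1 / (1 + t)) * x)) := by
    -- The linear factor is absorbed by a tilt so small that it changes the Gaussian integral only
    -- by a constant factor.
    have h4 : x ≤ (1 + t) * Real.exp (1 / (1 + t) * x) := by
      have := Real.add_one_le_exp (1 / (1 + t) * x)
      have h5 : x = (1 + t) * (1 / (1 + t) * x) := by field_simp
      nlinarith
    -- As `x ≥ t` and `2 ρ ≤ 1`, the tilt can be raised to `t`. Its Gaussian integral `exp (t ^ 2 /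
    -- 2)` against `exp (-t ^ 2)` leaves the size of a tail at `t`.
    have h5 : Real.exp (t * (2 * ρ * x)) ≤ Real.exp (2 * t ^ 2 * ρ - t ^ 2) * Real.exp (t * x) := by
      rw [← Real.exp_add, Real.exp_le_exp]
      nlinarith [mul_nonneg (mul_nonneg ht (sub_nonneg.2 htx)) (by linarith : 0 ≤ 1 - 2 * ρ)]
    calc x * Real.exp (t * (2 * ρ * x)) ≤ ((1 + t) * Real.exp (1 / (1 + t) * x)) *
          (Real.exp (2 * t ^ 2 * ρ - t ^ 2) * Real.exp (t * x)) := by gcongr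
      _ = _ := by rw [add_mul t, Real.exp_add]; ring
  calc gaussTail ((t - ρ * x) / s) - gaussTail t
      ≤ 2 * ρ * x * (Real.exp (-(t ^ 2 / 2)) * Real.exp (t * (2 * ρ * x))) := by
        linarith [gaussTail_anti h1]
    _ = 2 * ρ * Real.exp (-(t ^ 2 / 2)) * (x * Real.exp (t * (2 * ρ * x))) := by ring
    _ ≤ _ := by gcongr

theorem stdGaussian_real_inter_halfspace_sub_le {u v : E} (hu : ‖u‖ = 1) (hv : ‖v‖ = 1)
    (huv : |(inner ℝ u v : ℝ)| ≤ 1 / 2) {t : ℝ} (ht : 0 ≤ t) :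
    (stdGaussian E).real {x | t ≤ inner ℝ u x ∧ t ≤ inner ℝ v x} - gaussTail t ^ 2 ≤
      2 * Real.exp (3 / 2) * (1 + t) * |(inner ℝ u v : ℝ)| *
        Real.exp (2 * t ^ 2 * |(inner ℝ u v : ℝ)|) * Real.exp (-(t ^ 2 / 2)) ^ 2 := by
  set ρ : ℝ := inner ℝ u v with hρ
  obtain ⟨hρ1, hρ2⟩ := abs_le.1 huv
  have hs0 : 0 < 1 - ρ ^ 2 := by nlinarith
  set s := Real.sqrt (1 - ρ ^ 2) with hs
  have hspos : 0 < s := Real.sqrt_pos.2 hs0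
  have hs2 : s ^ 2 = 1 - ρ ^ 2 := Real.sq_sqrt hs0.le
  rw [stdGaussian_real_inter_halfspace_eq hu hv hspos hs2, ← hρ]
  have hm : max ρ 0 ≤ |ρ| := max_le (le_abs_self _) (abs_nonneg _)
  have hm0 : 0 ≤ max ρ 0 := le_max_right _ _
  set m := max ρ 0
  have hsq : gaussTail t ^ 2 = ∫ x in Set.Ici t, gaussTail t ∂(gaussianReal 0 1) := by
    rw [setIntegral_const, smul_eq_mul, ← gaussTail, sq]
  have hint : IntegrableOn (fun x => gaussTail ((t - ρ * x) / s)) (Set.Ici t)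
      (gaussianReal 0 1) := by
    refine Integrable.of_bound (C := 1) ?_ (ae_of_all _ fun x => ?_)
    · exact (continuous_gaussTail.comp (by fun_prop)).aestronglyMeasurable
    · rw [Real.norm_eq_abs, abs_of_nonneg (gaussTail_nonneg _)]
      exact measureReal_le_one
  have hint2 : Integrable (fun x => 2 * m * Real.exp (-(t ^ 2 / 2)) *
      ((1 + t) * (Real.exp (2 * t ^ 2 * m - t ^ 2) * Real.exp ((t + 1 / (1 + t)) * x))))
      (gaussianReal 0 1) :=
    (((integrable_exp_mul_gaussianReal _).const_mul _).const_mul _).const_mul _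
  rw [hsq, ← integral_sub hint (by simp)]
  have ht1 : 0 < 1 + t := by linarith
  calc ∫ x in Set.Ici t, (gaussTail ((t - ρ * x) / s) - gaussTail t) ∂(gaussianReal 0 1)
      ≤ ∫ x in Set.Ici t, 2 * m * Real.exp (-(t ^ 2 / 2)) * ((1 + t) *
          (Real.exp (2 * t ^ 2 * m - t ^ 2) * Real.exp ((t + 1 / (1 + t)) * x)))
          ∂(gaussianReal 0 1) :=
        setIntegral_mono_on (hint.sub (by simp)) hint2.integrableOn measurableSet_Ici
          fun x hx => gaussTail_div_sub_le ht hx hρ2 hspos hs2 hρ1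
    _ ≤ ∫ x, 2 * m * Real.exp (-(t ^ 2 / 2)) * ((1 + t) *
          (Real.exp (2 * t ^ 2 * m - t ^ 2) * Real.exp ((t + 1 / (1 + t)) * x)))
          ∂(gaussianReal 0 1) :=
        setIntegral_le_integral hint2 (ae_of_all _ fun x => by dsimp only; positivity)
    _ = 2 * m * Real.exp (-(t ^ 2 / 2)) * ((1 + t) * (Real.exp (2 * t ^ 2 * m - t ^ 2) *
          Real.exp ((t + 1 / (1 + t)) ^ 2 / 2))) := by
        simp only [integral_const_mul, integral_exp_mul_gaussianReal_std]
    _ ≤ 2 * |ρ| * Real.exp (-(t ^ 2 / 2)) * ((1 + t) * (Real.exp (2 * t ^ 2 * |ρ| - t ^ 2) *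
          Real.exp (t ^ 2 / 2 + 3 / 2))) := by
        gcongr
        have h1 : 0 < 1 / (1 + t) := by positivity
        have h2 : 1 / (1 + t) ≤ 1 := by rw [div_le_one ht1]; linarith
        have h3 : t * (1 / (1 + t)) ≤ 1 := by rw [mul_one_div, div_le_one ht1]; linarith
        nlinarith
    _ = _ := by
        have h1 : Real.exp (2 * t ^ 2 * |ρ| - t ^ 2) * Real.exp (t ^ 2 / 2 + 3 / 2) =
            Real.exp (3 / 2) * Real.exp (2 * t ^ 2 * |ρ|) * Real.exp (-(t ^ 2 / 2)) := by
          rw [← Real.exp_add, ← Real.exp_add, ← Real.exp_add]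
          ring_nf
        rw [h1]
        ring

/-- The constant in the covariance bound for two halfspaces. -/
def covConst : ℝ := 2 * Real.exp (3 / 2) * millsConst ^ 2

theorem one_le_covConst : 1 ≤ covConst := by
  have h1 : 1 ≤ Real.exp (3 / 2) := Real.one_le_exp (by norm_num)
  have h2 := one_le_millsConst
  unfold covConst
  nlinarith [one_le_pow₀ h2 (n := 2)]

/-- The covariance of two Gaussian halfspaces of measure `p`, in terms of the inner product of
their normal vectors. -/
theorem halfspace_covariance_le {u v : E} (hu : ‖u‖ = 1) (hv : ‖v‖ = 1) {t : ℝ} (ht : 0 ≤ t)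
    {L : ℝ} (hL : Real.exp (-L) = gaussTail t) (hL2 : Real.log 2 ≤ L) :
    (stdGaussian E).real {x | t ≤ inner ℝ u x ∧ t ≤ inner ℝ v x} - gaussTail t ^ 2 ≤
      covConst * gaussTail t ^ 2 * (1 + t) ^ 3 *
        (Real.exp |8 * L * inner ℝ u v| - 1) := by
  have hlog : (1 : ℝ) / 2 ≤ Real.log 2 := by linarith [Real.log_two_gt_d9]
  have hL0 : 0 < L := by linarith
  have hp0 := gaussTail_pos ht
  have hC := one_le_covConst
  have ht1 : 1 ≤ 1 + t := by linarith
  rw [abs_mul, abs_of_pos (by positivity : 0 < 8 * L)]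
  set ρ : ℝ := inner ℝ u v with hρ
  -- For nearly parallel normals the trivial bound `gaussTail t = gaussTail t ^ 2 * exp L` suffices,
  -- since `exp (8 L |ρ|)` then exceeds `exp (4 L)`. Otherwise the perturbative bound applies, and
  -- converting `exp (-t ^ 2)` to the squared tail costs `(1 + t) ^ 2`.
  rcases le_or_gt |ρ| (1 / 2) with h | h
  · refine (stdGaussian_real_inter_halfspace_sub_le hu hv h ht).trans ?_
    rw [← hρ]
    have hm := exp_le_gaussTail ht
    have ht2 : t ^ 2 ≤ 2 * L := by
      have := gaussTail_le_exp ht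
      rw [← hL, Real.exp_le_exp] at this
      linarith
    have hx : |ρ| * Real.exp (2 * t ^ 2 * |ρ|) ≤ Real.exp (8 * L * |ρ|) - 1 := by
      have h1 : Real.exp (2 * t ^ 2 * |ρ|) ≤ Real.exp (4 * L * |ρ|) := by
        refine Real.exp_le_exp.2 ?_
        nlinarith [abs_nonneg ρ]
      have h2 : Real.exp (8 * L * |ρ|) = Real.exp (4 * L * |ρ|) * Real.exp (4 * L * |ρ|) := by
        rw [← Real.exp_add]; ring_nf
      have h3 := Real.add_one_le_exp (4 * L * |ρ|)
      have h4 : |ρ| ≤ 4 * L * |ρ| := by nlinarith [abs_nonneg ρ]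
      have h5 : 0 ≤ |ρ| := abs_nonneg _
      rw [h2]
      nlinarith [Real.exp_pos (2 * t ^ 2 * |ρ|)]
    calc 2 * Real.exp (3 / 2) * (1 + t) * |ρ| * Real.exp (2 * t ^ 2 * |ρ|) *
          Real.exp (-(t ^ 2 / 2)) ^ 2
        ≤ 2 * Real.exp (3 / 2) * (1 + t) * |ρ| * Real.exp (2 * t ^ 2 * |ρ|) *
          (millsConst * (1 + t) * gaussTail t) ^ 2 := by gcongr
      _ = covConst * gaussTail t ^ 2 * (1 + t) ^ 3 * (|ρ| * Real.exp (2 * t ^ 2 * |ρ|)) := by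
          rw [covConst]; ring
      _ ≤ _ := by gcongr
  · have h1 : (stdGaussian E).real {x | t ≤ inner ℝ u x ∧ t ≤ inner ℝ v x} ≤ gaussTail t := by
      rw [← stdGaussian_real_halfspace hu t]
      exact measureReal_mono fun x hx => hx.1
    have h2 : Real.exp (4 * L) ≤ Real.exp (8 * L * |ρ|) := by
      refine Real.exp_le_exp.2 ?_
      nlinarith
    have h3 : Real.exp L + 1 ≤ Real.exp (4 * L) := by
      have h4 : 2 ≤ Real.exp L := by
        rw [← Real.exp_log two_pos]
        exact Real.exp_le_exp.2 hL2
      rw [show 4 * L = L + (L + (L + L)) by ring, Real.exp_add, Real.exp_add, Real.exp_add]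
      have h5 : 1 ≤ Real.exp L * Real.exp L := by nlinarith
      nlinarith
    have h4 : gaussTail t = gaussTail t ^ 2 * Real.exp L := by
      rw [← hL, sq, mul_assoc, ← Real.exp_add, neg_add_cancel, Real.exp_zero, mul_one]
    calc _ ≤ gaussTail t := by nlinarith [sq_nonneg (gaussTail t)]
      _ = gaussTail t ^ 2 * Real.exp L := h4
      _ ≤ 1 * gaussTail t ^ 2 * 1 * (Real.exp (8 * L * |ρ|) - 1) := by
          rw [one_mul, mul_one]
          gcongr
          linarith
      _ ≤ _ := by
          have : 0 ≤ Real.exp (8 * L * |ρ|) - 1 := by linarith [Real.exp_pos L]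
          gcongr
          exact one_le_pow₀ ht1

end Marginals

/-! ### Oracles that hide the input distribution -/

section Oracle

variable {X : Type*} [MeasurableSpace X]

/-- The oracle that returns the exact expectations. -/
def exactOracle (D : Measure X) : SQOracle X := fun q _ => ∫ x, q.toFun x ∂D

theorem isVSTATOracle_exactOracle (D : Measure X) : IsVSTATOracle D (exactOracle D) := by
  intro q u
  have : (0 : ℝ) < u := u.2
  simp only [exactOracle, sub_self, abs_zero]
  exact le_max_of_le_left (by positivity)

open Classical in
/-- The oracle for `D` that answers as if the input were `D₀` whenever this is admissible. -/
def hidingOracle (D₀ D : Measure X) : SQOracle X := fun q u =>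
  if |∫ x, q.toFun x ∂D₀ - ∫ x, q.toFun x ∂D| ≤
      max (1 / (u : ℝ)) (Real.sqrt (Var[q.toFun; D] / (u : ℝ)))
  then ∫ x, q.toFun x ∂D₀ else ∫ x, q.toFun x ∂D

theorem isVSTATOracle_hidingOracle (D₀ D : Measure X) :
    IsVSTATOracle D (hidingOracle D₀ D) := by
  intro q u
  unfold hidingOracle
  split_ifs with h
  · exact h
  · exact isVSTATOracle_exactOracle D q u

/-- Only the variance part of the tolerance is needed for the lower bound. -/
theorem lt_of_hidingOracle_ne {D₀ D : Measure X} {q : StatQuery X} {u : Set.Ioi (0 : ℝ)}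
    (h : hidingOracle D₀ D q u ≠ exactOracle D₀ q u) :
    Var[q.toFun; D] / (u : ℝ) < (∫ x, q.toFun x ∂D₀ - ∫ x, q.toFun x ∂D) ^ 2 := by
  have h1 : ¬ |∫ x, q.toFun x ∂D₀ - ∫ x, q.toFun x ∂D| ≤
      max (1 / (u : ℝ)) (Real.sqrt (Var[q.toFun; D] / (u : ℝ))) := fun hle =>
    h (by rw [hidingOracle, if_pos hle, exactOracle])
  have h2 := lt_of_le_of_lt (le_max_right _ _) (not_le.1 h1)
  rw [Real.sqrt_lt' (lt_of_le_of_lt (Real.sqrt_nonneg _) h2), sq_abs] at h2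
  exact h2

/-- An algorithm with few queries gets the same answers from most of the oracles in a family, when
each single query is answered differently from `O₀` by few of them. -/
theorem card_run_ne_le {Out ι : Type*} [DecidableEq Out] [Fintype ι] (O : ι → SQOracle X)
    (O₀ : SQOracle X)
    {U b : ℝ}
    (hb : ∀ (q : StatQuery X) (u : Set.Ioi (0 : ℝ)), (u : ℝ) < U →
      ((Finset.univ.filter fun v => O v q u ≠ O₀ q u).card : ℝ) ≤ b) (hb0 : 0 ≤ b)
    (a : SQAlgorithm X Out) (V : Finset ι) (n : ℕ)
    (hV : ∀ v ∈ V, (∀ u ∈ a.params (O v), u < U) ∧ (a.params (O v)).length ≤ n) :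
    ((V.filter fun v => a.run (O v) ≠ a.run O₀).card : ℝ) ≤ n * b := by
  classical
  induction a generalizing V n with
  | output o => simpa [SQAlgorithm.run] using mul_nonneg n.cast_nonneg hb0
  | ask q u next ih =>
    rcases V.eq_empty_or_nonempty with rfl | ⟨v₀, hv₀⟩
    · simpa using mul_nonneg n.cast_nonneg hb0
    have hu : (u : ℝ) < U := (hV v₀ hv₀).1 u (by simp [SQAlgorithm.params])
    obtain ⟨m, rfl⟩ : ∃ m, n = m + 1 := by
      have := (hV v₀ hv₀).2
      simp only [SQAlgorithm.params, List.length_cons] at this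
      exact ⟨n - 1, by omega⟩
    -- All indices in `W` continue with the same subalgorithm as `O₀`, to which the induction
    -- hypothesis applies with one query fewer. The others number at most `b`.
    set W := V.filter fun v => O v q u = O₀ q u
    have hW := ih (O₀ q u) W m (by
      intro v hv
      obtain ⟨hvV, hvq⟩ := Finset.mem_filter.1 hv
      obtain ⟨h1, h2⟩ := hV v hvV
      simp only [SQAlgorithm.params, List.length_cons, List.mem_cons, forall_eq_or_imp, hvq]
        at h1 h2
      exact ⟨h1.2, by omega⟩)
    have hsub : (V.filter fun v => (SQAlgorithm.ask q u next).run (O v) ≠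
        (SQAlgorithm.ask q u next).run O₀) ⊆
        (Finset.univ.filter fun v => O v q u ≠ O₀ q u) ∪
        (W.filter fun v => (next (O₀ q u)).run (O v) ≠ (next (O₀ q u)).run O₀) := by
      intro v hv
      obtain ⟨hvV, hvr⟩ := Finset.mem_filter.1 hv
      by_cases hvq : O v q u = O₀ q u
      · refine Finset.mem_union_right _ (Finset.mem_filter.2
          ⟨Finset.mem_filter.2 ⟨hvV, hvq⟩, ?_⟩)
        simpa only [SQAlgorithm.run, hvq] using hvr
      · exact Finset.mem_union_left _ (Finset.mem_filter.2 ⟨Finset.mem_univ _, hvq⟩)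
    calc _ ≤ (((Finset.univ.filter fun v => O v q u ≠ O₀ q u).card +
          (W.filter fun v => (next (O₀ q u)).run (O v) ≠ (next (O₀ q u)).run O₀).card : ℕ) : ℝ) :=
          Nat.cast_le.2 ((Finset.card_le_card hsub).trans (Finset.card_union_le _ _))
      _ ≤ b + m * b := by
          rw [Nat.cast_add]
          exact add_le_add (hb q u hu) hW
      _ = _ := by push_cast; ring

/-- Averaging: events of probability at least `α` occur simultaneously for at least a fraction `α`
of the indices. -/
theorem le_of_ae_card_le {ι Ω : Type*} [Fintype ι] [Nonempty ι] [MeasurableSpace Ω]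
    {P : Measure Ω} [IsProbabilityMeasure P] {S : ι → Set Ω} (hS : ∀ v, MeasurableSet (S v))
    {α β : ℝ} (hα : ∀ v, α ≤ P.real (S v)) [∀ ω, DecidablePred fun v => ω ∈ S v]
    (hβ : ∀ᵐ ω ∂P, ((Finset.univ.filter fun v => ω ∈ S v).card : ℝ) ≤ β * Fintype.card ι) :
    α ≤ β := by
  have hcard : 0 < (Fintype.card ι : ℝ) := by exact_mod_cast Fintype.card_pos
  have hint : ∀ v, Integrable ((S v).indicator (1 : Ω → ℝ)) P := fun v =>
    (integrable_const 1).indicator (hS v)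
  have h1 : ∫ ω, ∑ v, (S v).indicator (1 : Ω → ℝ) ω ∂P = ∑ v, P.real (S v) := by
    rw [integral_finsetSum _ fun v _ => hint v]
    exact Finset.sum_congr rfl fun v _ => integral_indicator_one (hS v)
  have h2 : ∫ ω, ∑ v, (S v).indicator (1 : Ω → ℝ) ω ∂P ≤ ∫ _, β * Fintype.card ι ∂P := by
    refine integral_mono_ae (integrable_finsetSum _ fun v _ => hint v) (integrable_const _) ?_
    filter_upwards [hβ] with ω hω
    refine le_trans (le_of_eq ?_) hω
    simp [Set.indicator_apply]
  have h3 : (Fintype.card ι : ℝ) * α ≤ ∑ v, P.real (S v) := by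
    have := Finset.card_nsmul_le_sum Finset.univ (fun v => P.real (S v)) α fun v _ => hα v
    simpa using this
  rw [h1, integral_const] at h2
  simp only [probReal_univ, one_smul] at h2
  nlinarith

end Oracle

/-! ### Correlations with a fixed function -/

section CauchySchwarz

variable {X : Type*} [MeasurableSpace X] {μ : Measure X}

theorem sq_integral_mul_le {h g : X → ℝ} (hh : MemLp h 2 μ) (hg : MemLp g 2 μ) :
    (∫ x, h x * g x ∂μ) ^ 2 ≤ (∫ x, h x ^ 2 ∂μ) * ∫ x, g x ^ 2 ∂μ := by
  have hhg : Integrable (fun x => h x * g x) μ := hh.integrable_mul hg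
  have key : ∀ s : ℝ, 0 ≤ (∫ x, g x ^ 2 ∂μ) * (s * s) + (-2 * ∫ x, h x * g x ∂μ) * s +
      ∫ x, h x ^ 2 ∂μ := by
    intro s
    have h1 : ∫ x, (h x - s * g x) ^ 2 ∂μ = (∫ x, g x ^ 2 ∂μ) * (s * s) +
        (-2 * ∫ x, h x * g x ∂μ) * s + ∫ x, h x ^ 2 ∂μ := by
      have h2 : ∀ x, (h x - s * g x) ^ 2 = (s * s) * g x ^ 2 + (-2 * s) * (h x * g x) + h x ^ 2 :=
        fun x => by ring
      simp_rw [h2]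
      have h3 : Integrable (fun x => (s * s) * g x ^ 2 + (-2 * s) * (h x * g x)) μ :=
        (hg.integrable_sq.const_mul _).add (hhg.const_mul _)
      rw [integral_add h3 hh.integrable_sq,
        integral_add (hg.integrable_sq.const_mul _) (hhg.const_mul _), integral_const_mul,
        integral_const_mul]
      ring
    rw [← h1]
    exact integral_nonneg fun x => sq_nonneg _
  have := discrim_le_zero key
  rw [discrim] at this
  nlinarith

/-- Many functions that correlate with the same `h` are correlated with each other. -/
theorem card_sq_mul_le_sum_correlation {ι : Type*} {S : Finset ι} (hS : S.Nonempty) {h : X → ℝ}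
    {g : ι → X → ℝ} (hh : MemLp h 2 μ) (hg : ∀ v, MemLp (g v) 2 μ) {τ : ℝ} (hτ : 0 < τ)
    (hpos : ∀ v ∈ S, 0 < ∫ x, h x * g v x ∂μ)
    (hcorr : ∀ v ∈ S, τ * ∫ x, h x ^ 2 ∂μ < (∫ x, h x * g v x ∂μ) ^ 2) :
    (S.card : ℝ) ^ 2 * τ ≤ ∑ u ∈ S, ∑ v ∈ S, ∫ x, g u x * g v x ∂μ := by
  set H := ∫ x, h x ^ 2 ∂μ with hH
  have hH0 : 0 ≤ H := integral_nonneg fun x => sq_nonneg _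
  -- If `h` had norm zero, Cauchy–Schwarz would force its correlations to vanish, against the strict
  -- inequality.
  have hHpos : 0 < H := by
    refine lt_of_le_of_ne hH0 fun h0 => ?_
    obtain ⟨v, hv⟩ := hS
    have h1 := sq_integral_mul_le hh (hg v)
    have h2 := hcorr v hv
    rw [← hH, ← h0] at h1
    rw [← h0] at h2
    linarith
  have hG : MemLp (fun x => ∑ v ∈ S, g v x) 2 μ := memLp_finsetSum _ fun v _ => hg v
  have hsum : ∫ x, h x * ∑ v ∈ S, g v x ∂μ = ∑ v ∈ S, ∫ x, h x * g v x ∂μ := by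
    simp_rw [Finset.mul_sum]
    exact integral_finsetSum _ fun v _ => hh.integrable_mul (hg v)
  have hsq : ∫ x, (∑ v ∈ S, g v x) ^ 2 ∂μ = ∑ u ∈ S, ∑ v ∈ S, ∫ x, g u x * g v x ∂μ := by
    simp_rw [sq, Finset.sum_mul_sum]
    have hi : ∀ u v, Integrable (fun x => g u x * g v x) μ := fun u v =>
      (hg u).integrable_mul (hg v)
    rw [integral_finsetSum _ fun u _ => integrable_finsetSum _ fun v _ => hi u v]
    exact Finset.sum_congr rfl fun u _ => integral_finsetSum _ fun v _ => hi u v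
  have h1 := sq_integral_mul_le hh hG
  rw [hsum, hsq, ← hH] at h1
  -- The common sign of the correlations prevents cancellation in the sum.
  have h2 : (S.card : ℝ) * Real.sqrt (τ * H) ≤ ∑ v ∈ S, ∫ x, h x * g v x ∂μ := by
    have := Finset.card_nsmul_le_sum S (fun v => ∫ x, h x * g v x ∂μ) (Real.sqrt (τ * H))
      fun v hv => Real.sqrt_le_iff.2 ⟨(hpos v hv).le, (hcorr v hv).le⟩
    simpa using this
  have h3 : ((S.card : ℝ) * Real.sqrt (τ * H)) ^ 2 ≤ (∑ v ∈ S, ∫ x, h x * g v x ∂μ) ^ 2 :=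
    pow_le_pow_left₀ (by positivity) h2 2
  rw [mul_pow, Real.sq_sqrt (by positivity)] at h3
  refine le_of_mul_le_mul_right ?_ hHpos
  linarith

end CauchySchwarz

/-! ### Noisy halfspaces -/

section Noise

variable {d : ℕ} {f : Euc d → Bool}

theorem integral_rcnDist (hf : Measurable f) {g : Euc d × Bool → ℝ} (hg : Measurable g) {C : ℝ}
    (hC : ∀ z, |g z| ≤ C) :
    ∫ z, g z ∂(rcnDist (1 / 3) f) =
      ∫ x, (2 / 3 * g (x, f x) + 1 / 3 * g (x, !f x)) ∂(stdGaussian (Euc d)) := by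
  have hf' : Measurable fun x => !f x := (measurable_of_countable not).comp hf
  have hm1 : Measurable fun x => (x, f x) := measurable_id.prodMk hf
  have hm2 : Measurable fun x => (x, !f x) := measurable_id.prodMk hf'
  have hint : ∀ (ν : Measure (Euc d × Bool)) [IsFiniteMeasure ν], Integrable g ν := fun ν _ =>
    Integrable.of_bound hg.aestronglyMeasurable C (ae_of_all _ hC)
  have hp1 : IsProbabilityMeasure ((stdGaussian (Euc d)).map fun x => (x, f x)) :=
    Measure.isProbabilityMeasure_map hm1.aemeasurable
  have hp2 : IsProbabilityMeasure ((stdGaussian (Euc d)).map fun x => (x, !f x)) :=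
    Measure.isProbabilityMeasure_map hm2.aemeasurable
  have hint' : ∀ k : Euc d → Bool, Measurable k →
      Integrable (fun x => g (x, k x)) (stdGaussian (Euc d)) := fun k hk =>
    Integrable.of_bound (hg.comp (measurable_id.prodMk hk)).aestronglyMeasurable C
      (ae_of_all _ fun x => hC _)
  rw [rcnDist, integral_add_measure ((hint _).smul_measure (by simp))
    ((hint _).smul_measure (by simp)), integral_smul_measure, integral_smul_measure,
    integral_map hm1.aemeasurable hg.aestronglyMeasurable,
    integral_map hm2.aemeasurable hg.aestronglyMeasurable,
    integral_add ((hint' f hf).const_mul _)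
      ((hint' (fun x => !f x) hf').const_mul _),
    integral_const_mul, integral_const_mul, ENNReal.toReal_ofReal (by norm_num),
    ENNReal.toReal_ofReal (by norm_num), smul_eq_mul, smul_eq_mul]
  norm_num

theorem integral_nullDist {p : ℝ} (hp0 : 0 ≤ p) (hp1 : p ≤ 1) {g : Euc d × Bool → ℝ}
    (hg : Measurable g) {C : ℝ} (hC : ∀ z, |g z| ≤ C) :
    ∫ z, g z ∂(nullDist d (1 / 3) p) =
      ∫ x, ((1 / 3 + p / 3) * g (x, true) + (2 / 3 - p / 3) * g (x, false))
        ∂(stdGaussian (Euc d)) := by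
  rw [nullDist]
  set ν : Measure Bool := ENNReal.ofReal (1 / 3 + (1 - 2 * (1 / 3)) * p) • Measure.dirac true +
      ENNReal.ofReal (1 - (1 / 3 + (1 - 2 * (1 / 3)) * p)) • Measure.dirac false with hν
  have hfin : IsFiniteMeasure ν := by
    refine ⟨?_⟩
    simp [hν, ENNReal.ofReal_lt_top]
  rw [integral_prod _ (Integrable.of_bound hg.aestronglyMeasurable C (ae_of_all _ hC))]
  congr 1
  funext x
  have hd : ∀ b : Bool, Integrable (fun y => g (x, y)) (Measure.dirac b) := fun b =>
    Integrable.of_bound (hg.comp measurable_prodMk_left).aestronglyMeasurable C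
      (ae_of_all _ fun y => hC _)
  rw [hν, integral_add_measure ((hd _).smul_measure (by simp)) ((hd _).smul_measure (by simp)),
    integral_smul_measure, integral_smul_measure, integral_dirac, integral_dirac,
    ENNReal.toReal_ofReal (by linarith), ENNReal.toReal_ofReal (by linarith), smul_eq_mul,
    smul_eq_mul]
  ring

/-- The centred indicator of the positive side of `f`, for a halfspace of measure `p`. -/
def centredIndicator (p : ℝ) (f : Euc d → Bool) (x : Euc d) : ℝ :=
  (if f x = true then 1 else 0) - p

theorem measurable_centredIndicator (hf : Measurable f) (p : ℝ) :
    Measurable (centredIndicator p f) :=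
  ((measurable_of_countable fun b : Bool => if b = true then (1 : ℝ) else 0).comp hf).sub_const p

theorem memLp_centredIndicator (hf : Measurable f) (p : ℝ) (q : ENNReal) :
    MemLp (centredIndicator p f) q (stdGaussian (Euc d)) := by
  refine MemLp.of_bound (measurable_centredIndicator hf p).aestronglyMeasurable (1 + |p|)
    (ae_of_all _ fun x => ?_)
  rw [centredIndicator, Real.norm_eq_abs]
  refine (abs_sub _ _).trans ?_
  split_ifs <;> simp

theorem integral_centredIndicator_mul {k : Euc d → Bool} (hf : Measurable f) (hk : Measurable k)
    {p : ℝ} (hfp : (stdGaussian (Euc d)).real {x | f x = true} = p)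
    (hkp : (stdGaussian (Euc d)).real {x | k x = true} = p) :
    ∫ x, centredIndicator p f x * centredIndicator p k x ∂(stdGaussian (Euc d)) =
      (stdGaussian (Euc d)).real {x | f x = true ∧ k x = true} - p ^ 2 := by
  have hmf : MeasurableSet {x | f x = true} := hf (measurableSet_singleton true)
  have hmk : MeasurableSet {x | k x = true} := hk (measurableSet_singleton true)
  have h1 : ∀ x, centredIndicator p f x * centredIndicator p k x =
      ({x | f x = true} ∩ {x | k x = true}).indicator 1 x -
        p * ({x | f x = true}).indicator 1 x - p * ({x | k x = true}).indicator 1 x + p ^ 2 := by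
    intro x
    by_cases h1 : f x = true <;> by_cases h2 : k x = true <;>
      simp [centredIndicator, h1, h2] <;> ring
  have hi : ∀ A : Set (Euc d), MeasurableSet A →
      Integrable (A.indicator (1 : Euc d → ℝ)) (stdGaussian (Euc d)) := fun A hA =>
    (integrable_const 1).indicator hA
  have hi2 : Integrable (fun x => ({x | f x = true} ∩ {x | k x = true}).indicator (1 : Euc d → ℝ) x -
      p * ({x | f x = true}).indicator 1 x) (stdGaussian (Euc d)) :=
    (hi _ (hmf.inter hmk)).sub ((hi _ hmf).const_mul _)
  have hi3 : Integrable (fun x => ({x | f x = true} ∩ {x | k x = true}).indicator (1 : Euc d → ℝ) x -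
      p * ({x | f x = true}).indicator 1 x - p * ({x | k x = true}).indicator 1 x)
      (stdGaussian (Euc d)) := hi2.sub ((hi _ hmk).const_mul _)
  simp_rw [h1]
  rw [integral_add hi3 (integrable_const _), integral_sub hi2 ((hi _ hmk).const_mul _),
    integral_sub (hi _ (hmf.inter hmk)) ((hi _ hmf).const_mul _), integral_const_mul,
    integral_const_mul, integral_indicator_one hmf, integral_indicator_one hmk,
    integral_indicator_one (hmf.inter hmk), hfp, hkp, integral_const, probReal_univ, one_smul]
  rw [show {x | f x = true} ∩ {x | k x = true} = {x | f x = true ∧ k x = true} from rfl]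
  ring

/-! ### Label dependence of a query -/

theorem abs_statQuery_le {X : Type*} [MeasurableSpace X] (q : StatQuery X) (x : X) :
    |q.toFun x| ≤ 1 := abs_le.2 (q.mem_Icc x)

/-- The part of a query that depends on the label. -/
def labelPart (q : StatQuery (Euc d × Bool)) (x : Euc d) : ℝ :=
  q.toFun (x, true) - q.toFun (x, false)

theorem measurable_labelPart (q : StatQuery (Euc d × Bool)) : Measurable (labelPart q) :=
  (q.measurable_toFun.comp (by fun_prop)).sub (q.measurable_toFun.comp (by fun_prop))

theorem abs_labelPart_le (q : StatQuery (Euc d × Bool)) (x : Euc d) : |labelPart q x| ≤ 2 := by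
  refine (abs_sub _ _).trans ?_
  linarith [abs_statQuery_le q (x, true), abs_statQuery_le q (x, false)]

theorem memLp_labelPart (q : StatQuery (Euc d × Bool)) (r : ENNReal) :
    MemLp (labelPart q) r (stdGaussian (Euc d)) :=
  MemLp.of_bound (measurable_labelPart q).aestronglyMeasurable 2
    (ae_of_all _ fun x => abs_labelPart_le q x)

/-- Given `x`, the probability of the label `true` is `1 / 3 + p / 3` under the null distribution
and `1 / 3` plus a third of the indicator of `f` under the noisy one. The marginal in `x` is common,
so only the label part survives. -/
theorem integral_nullDist_sub_integral_rcnDist (hf : Measurable f) {p : ℝ} (hp0 : 0 ≤ p)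
    (hp1 : p ≤ 1) (q : StatQuery (Euc d × Bool)) :
    ∫ z, q.toFun z ∂(nullDist d (1 / 3) p) - ∫ z, q.toFun z ∂(rcnDist (1 / 3) f) =
      -(1 / 3) * ∫ x, labelPart q x * centredIndicator p f x ∂(stdGaussian (Euc d)) := by
  have hi : ∀ k : Euc d → Bool, Measurable k →
      Integrable (fun x => q.toFun (x, k x)) (stdGaussian (Euc d)) := fun k hk =>
    Integrable.of_bound (q.measurable_toFun.comp (measurable_id.prodMk hk)).aestronglyMeasurable 1
      (ae_of_all _ fun x => abs_statQuery_le q _)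
  have hf' : Measurable fun x => !f x := (measurable_of_countable not).comp hf
  have h1 : Integrable (fun x => (1 / 3 + p / 3) * q.toFun (x, true) +
      (2 / 3 - p / 3) * q.toFun (x, false)) (stdGaussian (Euc d)) :=
    ((hi _ measurable_const).const_mul _).add ((hi _ measurable_const).const_mul _)
  have h2 : Integrable (fun x => 2 / 3 * q.toFun (x, f x) + 1 / 3 * q.toFun (x, !f x))
      (stdGaussian (Euc d)) := ((hi f hf).const_mul _).add ((hi _ hf').const_mul _)
  rw [integral_nullDist hp0 hp1 q.measurable_toFun (abs_statQuery_le q),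
    integral_rcnDist hf q.measurable_toFun (abs_statQuery_le q), ← integral_const_mul,
    ← integral_sub h1 h2]
  congr 1
  funext x
  cases hx : f x <;> simp [labelPart, centredIndicator, hx] <;> ring

/-- This is where the noise enters: given `x`, both labels have probability at least `1 / 3`, so a
query that depends on the label fluctuates even for fixed `x`. The constant is not sharp. -/
theorem integral_labelPart_sq_le_variance (hf : Measurable f) (q : StatQuery (Euc d × Bool)) :
    1 / 6 * ∫ x, labelPart q x ^ 2 ∂(stdGaussian (Euc d)) ≤ Var[q.toFun; rcnDist (1 / 3) f] := by
  rw [variance_eq_integral q.measurable_toFun.aemeasurable]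
  set m := ∫ z, q.toFun z ∂(rcnDist (1 / 3) f)
  have hC : ∀ z, |(q.toFun z - m) ^ 2| ≤ (1 + |m|) ^ 2 := by
    intro z
    rw [abs_pow]
    exact pow_le_pow_left₀ (abs_nonneg _)
      ((abs_sub _ _).trans (add_le_add_left (abs_statQuery_le q z) _)) 2
  have hmeas : Measurable fun z => (q.toFun z - m) ^ 2 := (q.measurable_toFun.sub_const m).pow_const 2
  rw [integral_rcnDist hf hmeas hC, ← integral_const_mul]
  have hi : ∀ k : Euc d → Bool, Measurable k →
      Integrable (fun x => (q.toFun (x, k x) - m) ^ 2) (stdGaussian (Euc d)) := fun k hk =>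
    Integrable.of_bound (hmeas.comp (measurable_id.prodMk hk)).aestronglyMeasurable _
      (ae_of_all _ fun x => hC _)
  have hf' : Measurable fun x => !f x := (measurable_of_countable not).comp hf
  refine integral_mono ((memLp_labelPart q 2).integrable_sq.const_mul _)
    (((hi f hf).const_mul _).add ((hi _ hf').const_mul _)) fun x => ?_
  simp only [labelPart]
  cases hx : f x <;> simp only [Bool.not_true, Bool.not_false] <;>
    nlinarith [sq_nonneg (q.toFun (x, true) - m + (q.toFun (x, false) - m)),
      sq_nonneg (q.toFun (x, true) - m), sq_nonneg (q.toFun (x, false) - m)]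

/-- When the oracle cannot hide a noisy halfspace, the label part of the query is correlated
with it. -/
theorem labelPart_correlation_of_hidingOracle_ne (hf : Measurable f) {p : ℝ} (hp0 : 0 ≤ p)
    (hp1 : p ≤ 1) {q : StatQuery (Euc d × Bool)} {u : Set.Ioi (0 : ℝ)}
    (h : hidingOracle (nullDist d (1 / 3) p) (rcnDist (1 / 3) f) q u ≠
      exactOracle (nullDist d (1 / 3) p) q u) {U : ℝ} (hU : (u : ℝ) < U) :
    3 / (2 * U) * ∫ x, labelPart q x ^ 2 ∂(stdGaussian (Euc d)) <
      (∫ x, labelPart q x * centredIndicator p f x ∂(stdGaussian (Euc d))) ^ 2 := by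
  have h1 := lt_of_hidingOracle_ne h
  rw [integral_nullDist_sub_integral_rcnDist hf hp0 hp1] at h1
  have h2 := integral_labelPart_sq_le_variance hf q
  have hu : (0 : ℝ) < u := u.2
  have hH : 0 ≤ ∫ x, labelPart q x ^ 2 ∂(stdGaussian (Euc d)) := integral_nonneg fun x => sq_nonneg _
  set H := ∫ x, labelPart q x ^ 2 ∂(stdGaussian (Euc d))
  -- The `9` undoes the square of the signal factor `1 / 3`, and `9 / 6 = 3 / 2`.
  have h3 : 3 / (2 * U) * H ≤ 9 * (Var[q.toFun; rcnDist (1 / 3) f] / u) := by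
    calc 3 / (2 * U) * H ≤ 3 / (2 * u) * H := by gcongr
      _ = 9 * (1 / 6 * H / u) := by field_simp; ring
      _ ≤ _ := by gcongr
  nlinarith

end Noise

/-! ### Halfspaces with normal vectors in the cube -/

section Cube

variable {d : ℕ}

/-- The unit vector in the direction of a vector of signs. -/
def signVec (v : Fin d → Bool) : Euc d :=
  (Real.sqrt d)⁻¹ • WithLp.toLp 2 fun i => boolSign (v i)

theorem inner_signVec (u v : Fin d → Bool) :
    (inner ℝ (signVec u) (signVec v) : ℝ) = signInner u v / d := by
  have h : (Real.sqrt d)⁻¹ * (Real.sqrt d)⁻¹ = (d : ℝ)⁻¹ := by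
    rw [← mul_inv, Real.mul_self_sqrt d.cast_nonneg]
  rw [signVec, signVec, inner_smul_left, inner_smul_right, ← mul_assoc, conj_trivial, h,
    signInner, PiLp.inner_apply, div_eq_inv_mul]
  congr 1
  exact Finset.sum_congr rfl fun i _ => by simp [mul_comm]

theorem norm_signVec (hd : 0 < d) (v : Fin d → Bool) : ‖signVec v‖ = 1 := by
  have h1 : signInner v v = d := by
    have : ∀ b, boolSign b * boolSign b = 1 := by intro b; cases b <;> simp [boolSign]
    simp [signInner, this]
  have h2 : ‖signVec v‖ ^ 2 = 1 := by
    rw [← real_inner_self_eq_norm_sq, inner_signVec, h1, div_self (by positivity)]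
  exact (pow_eq_one_iff_of_nonneg (norm_nonneg _) two_ne_zero).1 h2

theorem signVec_not (v : Fin d → Bool) : signVec (fun i => !v i) = -signVec v := by
  rw [signVec, signVec, ← smul_neg]
  congr 1
  ext i
  cases h : v i <;> simp [boolSign, h]

/-- The halfspace at distance `t` from the origin with the normal vector `signVec v`. -/
def signHalfspace (t : ℝ) (v : Fin d → Bool) (x : Euc d) : Bool :=
  decide (t ≤ inner ℝ (signVec v) x)

theorem signHalfspace_eq_true {t : ℝ} {v : Fin d → Bool} {x : Euc d} :
    signHalfspace t v x = true ↔ t ≤ inner ℝ (signVec v) x := by simp [signHalfspace]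

theorem measurable_signHalfspace (t : ℝ) (v : Fin d → Bool) : Measurable (signHalfspace t v) := by
  refine measurable_to_bool ?_
  have : signHalfspace t v ⁻¹' {true} = {x | t ≤ inner ℝ (signVec v) x} := by
    ext x
    exact signHalfspace_eq_true
  rw [this]
  exact measurableSet_le (by fun_prop) (by fun_prop)

theorem isHalfspace_signHalfspace (t : ℝ) (v : Fin d → Bool) : IsHalfspace (signHalfspace t v) :=
  ⟨signVec v, -t, fun x => by rw [signHalfspace_eq_true]; constructor <;> intro h <;> linarith⟩

theorem stdGaussian_real_signHalfspace (hd : 0 < d) (t : ℝ) (v : Fin d → Bool) :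
    (stdGaussian (Euc d)).real {x | signHalfspace t v x = true} = gaussTail t := by
  simp_rw [signHalfspace_eq_true]
  exact stdGaussian_real_halfspace (norm_signVec hd v) t

theorem isBiased_signHalfspace (hd : 0 < d) {t : ℝ} (ht : gaussTail t ≤ 1 / 2)
    (v : Fin d → Bool) : IsBiased (gaussTail t) (signHalfspace t v) := by
  have h := stdGaussian_real_signHalfspace hd t v
  have hm : MeasurableSet {x | signHalfspace t v x = true} :=
    measurable_signHalfspace t v (measurableSet_singleton true)
  have hc : {x | signHalfspace t v x = false} = {x | signHalfspace t v x = true}ᶜ := by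
    ext x
    simp
  rw [IsBiased, hc, probReal_compl_eq_one_sub hm, h]
  exact min_eq_left (by linarith)

theorem rcnDist_mem_biasedClass (hd : 0 < d) {t : ℝ} (ht : gaussTail t ≤ 1 / 2)
    (v : Fin d → Bool) :
    rcnDist (1 / 3) (signHalfspace t v) ∈ biasedClass d (1 / 3) (gaussTail t) :=
  ⟨_, isHalfspace_signHalfspace t v, isBiased_signHalfspace hd ht v, rfl⟩

theorem rcnDist_mem_posClass (hd : 0 < d) (t : ℝ) (v : Fin d → Bool) :
    rcnDist (1 / 3) (signHalfspace t v) ∈ posClass d (1 / 3) (gaussTail t) :=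
  ⟨_, isHalfspace_signHalfspace t v, stdGaussian_real_signHalfspace hd t v, rfl⟩

/-- Only few of the halfspaces are positively correlated with a given function. -/
theorem card_correlated_le (hd : 0 < d) {t L X δ τ : ℝ} (ht : 0 ≤ t)
    (hL : Real.exp (-L) = gaussTail t) (hL2 : Real.log 2 ≤ L)
    (hδ : Real.exp (32 * L ^ 2 / d + 16 * L * X / d) - 1 ≤ δ) (hτ0 : 0 < τ)
    (hτ : covConst * gaussTail t ^ 2 * (1 + t) ^ 3 * (Real.sqrt (2 * δ) + 2 * δ) < τ)
    {h : Euc d → ℝ} (hh : MemLp h 2 (stdGaussian (Euc d))) :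
    ((Finset.univ.filter fun v : Fin d → Bool =>
      0 < ∫ x, h x * centredIndicator (gaussTail t) (signHalfspace t v) x
        ∂(stdGaussian (Euc d)) ∧
      τ * ∫ x, h x ^ 2 ∂(stdGaussian (Euc d)) <
        (∫ x, h x * centredIndicator (gaussTail t) (signHalfspace t v) x
          ∂(stdGaussian (Euc d))) ^ 2).card : ℝ) ≤ Real.exp (-X) * 2 ^ d := by
  set S := Finset.univ.filter fun v : Fin d → Bool =>
      0 < ∫ x, h x * centredIndicator (gaussTail t) (signHalfspace t v) x
        ∂(stdGaussian (Euc d)) ∧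
      τ * ∫ x, h x ^ 2 ∂(stdGaussian (Euc d)) <
        (∫ x, h x * centredIndicator (gaussTail t) (signHalfspace t v) x
          ∂(stdGaussian (Euc d))) ^ 2 with hSdef
  have hmem := fun v (hv : v ∈ S) => (Finset.mem_filter.1 hv).2
  clear_value S
  by_contra hlt
  rw [not_le] at hlt
  have hScard : 0 < (S.card : ℝ) := lt_trans (by positivity) hlt
  have hS : S.Nonempty := Finset.card_pos.1 (by exact_mod_cast hScard)
  have hL0 : 0 < L := lt_of_lt_of_le (Real.log_pos one_lt_two) hL2
  have hd0 : (0 : ℝ) < d := by exact_mod_cast hd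
  have hdl : (d : ℝ) * (8 * L / d) ^ 2 / 2 = 32 * L ^ 2 / d := by
    field_simp
    ring
  have hcorr := card_sq_mul_le_sum_correlation hS hh
    (fun v => memLp_centredIndicator (measurable_signHalfspace t v) (gaussTail t) 2) hτ0
    (fun v hv => (hmem v hv).1) (fun v hv => (hmem v hv).2)
  have hcov : ∀ u v : Fin d → Bool,
      ∫ x, centredIndicator (gaussTail t) (signHalfspace t u) x *
        centredIndicator (gaussTail t) (signHalfspace t v) x ∂(stdGaussian (Euc d)) ≤
      covConst * gaussTail t ^ 2 * (1 + t) ^ 3 *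
        (Real.exp |8 * L / d * signInner u v| - 1) := by
    intro u v
    rw [integral_centredIndicator_mul (measurable_signHalfspace t u) (measurable_signHalfspace t v)
      (stdGaussian_real_signHalfspace hd t u) (stdGaussian_real_signHalfspace hd t v)]
    simp_rw [signHalfspace_eq_true]
    refine (halfspace_covariance_le (norm_signVec hd u) (norm_signVec hd v) ht hL hL2).trans
      (le_of_eq ?_)
    rw [inner_signVec, mul_div_assoc', div_mul_eq_mul_div]
  have hlog : Real.log (2 ^ d / S.card) ≤ X := by
    rw [Real.log_le_iff_le_exp (div_pos (by positivity) hScard), div_le_iff₀ hScard]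
    calc (2 : ℝ) ^ d = Real.exp X * (Real.exp (-X) * 2 ^ d) := by
          rw [← mul_assoc, ← Real.exp_add, add_neg_cancel, Real.exp_zero, one_mul]
      _ ≤ _ := by gcongr
  -- The normals have inner product `signInner u v / d`, so the exponent `8 L ρ` of the covariance
  -- bound corresponds to `l = 8 L / d`.
  have hexp := sum_exp_abs_signInner_le (l := 8 * L / d) (by positivity) hS (δ := δ) (by
    refine le_trans (sub_le_sub_right (Real.exp_le_exp.2 ?_) 1) hδ
    have h2 : 2 * (8 * L / d) * X = 16 * L * X / d := by ring
    rw [hdl, ← h2]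
    gcongr)
  have hC : 0 ≤ covConst * gaussTail t ^ 2 * (1 + t) ^ 3 := by
    have := one_le_covConst
    positivity
  have hfin : (S.card : ℝ) ^ 2 * τ ≤ (S.card : ℝ) ^ 2 *
      (covConst * gaussTail t ^ 2 * (1 + t) ^ 3 * (Real.sqrt (2 * δ) + 2 * δ)) := by
    calc (S.card : ℝ) ^ 2 * τ ≤ _ := hcorr
      _ ≤ ∑ u ∈ S, ∑ v ∈ S, covConst * gaussTail t ^ 2 * (1 + t) ^ 3 *
          (Real.exp |8 * L / d * signInner u v| - 1) :=
          Finset.sum_le_sum fun u _ => Finset.sum_le_sum fun v _ => hcov u v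
      _ = covConst * gaussTail t ^ 2 * (1 + t) ^ 3 *
          ∑ u ∈ S, ∑ v ∈ S, (Real.exp |8 * L / d * signInner u v| - 1) := by
          simp_rw [Finset.mul_sum]
      _ ≤ covConst * gaussTail t ^ 2 * (1 + t) ^ 3 *
          ((S.card : ℝ) ^ 2 * (Real.sqrt (2 * δ) + 2 * δ)) := by gcongr
      _ = _ := by ring
  exact absurd (le_of_mul_le_mul_left hfin (pow_pos hScard 2)) (not_le.2 hτ)

/-- The oracle can hide all but few of the noisy halfspaces from a query of low accuracy. -/
theorem card_hidingOracle_ne_le (hd : 0 < d) {t L X δ U : ℝ} (ht : 0 ≤ t)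
    (hL : Real.exp (-L) = gaussTail t) (hL2 : Real.log 2 ≤ L)
    (hδ : Real.exp (32 * L ^ 2 / d + 16 * L * X / d) - 1 ≤ δ) (hU0 : 0 < U)
    (hU : covConst * gaussTail t ^ 2 * (1 + t) ^ 3 * (Real.sqrt (2 * δ) + 2 * δ) < 3 / (2 * U))
    (q : StatQuery (Euc d × Bool)) (u : Set.Ioi (0 : ℝ)) (hu : (u : ℝ) < U) :
    ((Finset.univ.filter fun v : Fin d → Bool =>
      hidingOracle (nullDist d (1 / 3) (gaussTail t)) (rcnDist (1 / 3) (signHalfspace t v)) q u ≠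
        exactOracle (nullDist d (1 / 3) (gaussTail t)) q u).card : ℝ) ≤
      2 * Real.exp (-X) * 2 ^ d := by
  have hτ0 : 0 < 3 / (2 * U) := by positivity
  have h1 := card_correlated_le hd ht hL hL2 hδ hτ0 hU (memLp_labelPart q 2)
  -- Instances with a negative correlation are counted through the negated label part, whence the
  -- factor `2`.
  have h2 := card_correlated_le hd ht hL hL2 hδ hτ0 hU (memLp_labelPart q 2).neg
  have hp1 : gaussTail t ≤ 1 := measureReal_le_one
  set A := Finset.univ.filter fun v : Fin d → Bool =>
      0 < ∫ x, labelPart q x * centredIndicator (gaussTail t) (signHalfspace t v) x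
        ∂(stdGaussian (Euc d)) ∧
      3 / (2 * U) * ∫ x, labelPart q x ^ 2 ∂(stdGaussian (Euc d)) <
        (∫ x, labelPart q x * centredIndicator (gaussTail t) (signHalfspace t v) x
          ∂(stdGaussian (Euc d))) ^ 2
  set B := Finset.univ.filter fun v : Fin d → Bool =>
      0 < ∫ x, (-labelPart q) x * centredIndicator (gaussTail t) (signHalfspace t v) x
        ∂(stdGaussian (Euc d)) ∧
      3 / (2 * U) * ∫ x, (-labelPart q) x ^ 2 ∂(stdGaussian (Euc d)) <
        (∫ x, (-labelPart q) x * centredIndicator (gaussTail t) (signHalfspace t v) x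
          ∂(stdGaussian (Euc d))) ^ 2 with hB
  have hsub : (Finset.univ.filter fun v : Fin d → Bool =>
      hidingOracle (nullDist d (1 / 3) (gaussTail t)) (rcnDist (1 / 3) (signHalfspace t v)) q u ≠
        exactOracle (nullDist d (1 / 3) (gaussTail t)) q u) ⊆ A ∪ B := by
    intro v hv
    have hc := labelPart_correlation_of_hidingOracle_ne (measurable_signHalfspace t v)
      (gaussTail_nonneg t) hp1 (Finset.mem_filter.1 hv).2 hu
    have hH : 0 ≤ ∫ x, labelPart q x ^ 2 ∂(stdGaussian (Euc d)) :=
      integral_nonneg fun x => sq_nonneg _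
    have hne : ∫ x, labelPart q x * centredIndicator (gaussTail t) (signHalfspace t v) x
        ∂(stdGaussian (Euc d)) ≠ 0 := by
      intro h0
      rw [h0] at hc
      have := mul_nonneg hτ0.le hH
      linarith
    rcases hne.lt_or_gt with hlt | hgt
    · refine Finset.mem_union_right _ (Finset.mem_filter.2 ⟨Finset.mem_univ _, ?_⟩)
      simp only [Pi.neg_apply, neg_mul, integral_neg, neg_sq]
      exact ⟨neg_pos.2 hlt, hc⟩
    · exact Finset.mem_union_left _ (Finset.mem_filter.2 ⟨Finset.mem_univ _, hgt, hc⟩)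
  calc _ ≤ ((A.card + B.card : ℕ) : ℝ) :=
        Nat.cast_le.2 ((Finset.card_le_card hsub).trans (Finset.card_union_le _ _))
    _ ≤ _ := by push_cast; linarith

end Cube

/-! ### The error of a hypothesis -/

section Error

variable {d : ℕ}

/-- Noise rescales the disagreement with `f` by `1 - 2 η = 1 / 3` and adds `η`. The learner's goal
thus amounts to disagreement less than `p`. -/
theorem err_rcnDist {f : Euc d → Bool} (hf : Measurable f) (h : Hypothesis d) :
    err (rcnDist (1 / 3) f) h =
      1 / 3 + 1 / 3 * (stdGaussian (Euc d)).real {x | h.1 x ≠ f x} := by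
  have hm : MeasurableSet {z : Euc d × Bool | h.1 z.1 ≠ z.2} :=
    (measurableSet_eq_fun (h.2.comp measurable_fst) measurable_snd).compl
  have hm' : MeasurableSet {x | h.1 x ≠ f x} := (measurableSet_eq_fun h.2 hf).compl
  rw [err, ← integral_indicator_one hm, integral_rcnDist hf (C := 1)
    (measurable_one.indicator hm) (fun z => by
      rw [Set.indicator_apply]; split_ifs <;> simp)]
  have h1 : ∀ x, 2 / 3 * ({z : Euc d × Bool | h.1 z.1 ≠ z.2}).indicator (1 : Euc d × Bool → ℝ) (x, f x) +
      1 / 3 * ({z : Euc d × Bool | h.1 z.1 ≠ z.2}).indicator (1 : Euc d × Bool → ℝ) (x, !f x) =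
      1 / 3 + 1 / 3 * ({x | h.1 x ≠ f x}).indicator (1 : Euc d → ℝ) x := by
    intro x
    cases h1 : f x <;> cases h2 : h.1 x <;> simp [h1, h2] <;> norm_num
  simp_rw [h1]
  rw [integral_add (integrable_const _)
    (((integrable_const 1).indicator hm').const_mul _), integral_const_mul,
    integral_indicator_one hm', integral_const, probReal_univ, one_smul]

/-- No hypothesis is good for two opposite halfspaces. -/
theorem two_mul_gaussTail_le (hd : 0 < d) {t : ℝ} (ht : 0 ≤ t) (v : Fin d → Bool)
    (h : Hypothesis d) :
    2 * gaussTail t ≤ (stdGaussian (Euc d)).real {x | h.1 x ≠ signHalfspace t v x} +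
      (stdGaussian (Euc d)).real {x | h.1 x ≠ signHalfspace t (fun i => !v i) x} := by
  set γ := stdGaussian (Euc d)
  set A := {x : Euc d | signHalfspace t v x = true} with hA
  set B := {x : Euc d | signHalfspace t (fun i => !v i) x = true} with hB
  have hAB : γ.real (A ∩ B) = 0 := by
    have : NullSingletonClass (gaussianReal 0 1) := nullSingletonClass_gaussianReal one_ne_zero
    have h0 : γ.real {x | (inner ℝ (signVec v) x : ℝ) = 0} = 0 := by
      have h1 : (gaussianReal 0 1).real {0} = 0 := by simp [measureReal_def]
      rw [← stdGaussian_map_inner (norm_signVec hd v), map_measureReal_apply (by fun_prop)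
        (measurableSet_singleton _)] at h1
      exact h1
    -- Opposite halfspaces with `t ≥ 0` can meet only in the bounding hyperplane through the origin,
    -- which is null; this covers `t = 0`.
    refine le_antisymm (h0 ▸ measureReal_mono fun x hx => ?_) measureReal_nonneg
    have h1 := signHalfspace_eq_true.1 hx.1
    have h2 := signHalfspace_eq_true.1 hx.2
    rw [signVec_not, inner_neg_left] at h2
    exact le_antisymm (by linarith) (by linarith)
  have hmB : MeasurableSet B := measurable_signHalfspace _ _ (measurableSet_singleton true)
  have h1 := measureReal_union_add_inter (μ := γ) (s := A) hmB
  rw [hAB, add_zero] at h1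
  have h2 : γ.real A = gaussTail t := stdGaussian_real_signHalfspace hd t v
  have h3 : γ.real B = gaussTail t := stdGaussian_real_signHalfspace hd t _
  have h4 : A ∪ B ⊆ ({x | h.1 x ≠ signHalfspace t v x} ∪
      {x | h.1 x ≠ signHalfspace t (fun i => !v i) x}) ∪ (A ∩ B) := by
    intro x hx
    simp only [hA, hB, Set.mem_union, Set.mem_inter_iff, Set.mem_ofPred_eq] at hx ⊢
    cases hv : signHalfspace t v x <;> cases hv' : signHalfspace t (fun i => !v i) x <;>
      cases hh : h.1 x <;> simp_all
  have h5 := (measureReal_mono (μ := γ) h4).trans (measureReal_union_le _ _)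
  have h6 := measureReal_union_le (μ := γ) {x | h.1 x ≠ signHalfspace t v x}
    {x | h.1 x ≠ signHalfspace t (fun i => !v i) x}
  rw [hAB, add_zero] at h5
  linarith

/-- The set of `v` for which `h` succeeds is disjoint from its image under negation, so it fills at
most half of the cube. -/
theorem two_mul_card_err_lt_le (hd : 0 < d) {t : ℝ} (ht : 0 ≤ t) (h : Hypothesis d) :
    2 * (Finset.univ.filter fun v : Fin d → Bool =>
      err (rcnDist (1 / 3) (signHalfspace t v)) h < 1 / 3 + gaussTail t / 3).card ≤ 2 ^ d := by
  set G := Finset.univ.filter fun v : Fin d → Bool =>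
      err (rcnDist (1 / 3) (signHalfspace t v)) h < 1 / 3 + gaussTail t / 3 with hG
  have hinj : Function.Injective (fun (v : Fin d → Bool) (i : Fin d) => !v i) := by
    intro v w h
    funext i
    simpa using congrFun h i
  have hdisj : Disjoint G (G.image fun v i => !v i) := by
    refine Finset.disjoint_left.2 fun w hw hw' => ?_
    obtain ⟨v, hv, rfl⟩ := Finset.mem_image.1 hw'
    have h1 := (Finset.mem_filter.1 hv).2
    have h2 := (Finset.mem_filter.1 hw).2
    rw [err_rcnDist (measurable_signHalfspace _ _)] at h1 h2
    linarith [two_mul_gaussTail_le hd ht v h]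
  have h1 := Finset.card_le_univ (G ∪ G.image fun v i => !v i)
  rw [Finset.card_union_of_disjoint hdisj, Finset.card_image_of_injective _ hinj] at h1
  simp only [Fintype.card_pi, Fintype.card_bool, Finset.prod_const, Finset.card_univ,
    Fintype.card_fin] at h1
  omega

end Error

/-! ### Choice of the parameters -/

theorem sqrt_two_mul_add_two_mul_le {e : ℝ} (he0 : 0 ≤ e) (he1 : e ≤ 1) :
    Real.sqrt (2 * (2 * e)) + 2 * (2 * e) ≤ 6 * Real.sqrt e := by
  have h1 : Real.sqrt (2 * (2 * e)) = 2 * Real.sqrt e := by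
    rw [show 2 * (2 * e) = 2 ^ 2 * e by ring, Real.sqrt_mul (by norm_num),
      Real.sqrt_sq (by norm_num)]
  have h2 : e ≤ Real.sqrt e := by
    refine Real.le_sqrt_of_sq_le ?_
    nlinarith
  linarith

theorem one_add_pow_three_le {t L : ℝ} (ht : 0 ≤ t) (hL : 1 / 2 ≤ L) (htL : t ^ 2 ≤ 2 * L) :
    (1 + t) ^ 3 ≤ 64 * L ^ 2 := by
  have h1 : (1 + t) ^ 2 ≤ 8 * L := by nlinarith [sq_nonneg (1 - t)]
  calc (1 + t) ^ 3 ≤ (1 + t) ^ 4 := pow_le_pow_right₀ (by linarith) (by norm_num)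
    _ = ((1 + t) ^ 2) ^ 2 := by ring
    _ ≤ (8 * L) ^ 2 := by gcongr
    _ = _ := by ring

/-- The constant `A` in the accuracy threshold. -/
def thresholdConst (B : ℝ) : ℝ :=
  12 / (384 * covConst * Real.sqrt (32 * (2 * B + 1)) + 1)

theorem thresholdConst_pos (B : ℝ) : 0 < thresholdConst B := by
  have := one_le_covConst
  unfold thresholdConst
  positivity

/-- Three powers of `L` have to be absorbed: two from `(1 + t) ^ 3` and one from the square root of
the exponent. As `log M ≥ 2 L`, the choice `k = 3` pays for them. -/
theorem accuracyThreshold_bounds {B c D p L t : ℝ} {d : ℕ} (hD : (d : ℝ) = D) (hc0 : 0 < c)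
    (hc : c < 1 / 2) (hB : 0 < B) (hD1 : 1 ≤ D) (hL : Real.exp (-L) = p) (hL2 : Real.log 2 ≤ L)
    (hLB : L ≤ B * D ^ c) (ht : 0 ≤ t) (htL : t ^ 2 ≤ 2 * L)
    (hDB : 16 * (2 * B + 1) * B * D ^ (2 * c - 1) ≤ 1) :
    0 < accuracyThreshold (thresholdConst B) 3 c d p ∧
    ∃ δ, Real.exp (32 * L ^ 2 / D + 16 * L * D ^ c / D) - 1 ≤ δ ∧
      covConst * p ^ 2 * (1 + t) ^ 3 * (Real.sqrt (2 * δ) + 2 * δ) <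
        3 / (2 * accuracyThreshold (thresholdConst B) 3 c d p) := by
  have hlog : (1 : ℝ) / 2 ≤ Real.log 2 := by linarith [Real.log_two_gt_d9]
  have hL12 : 1 / 2 ≤ L := hlog.trans hL2
  have hL0 : 0 < L := by linarith
  have hD0 : 0 < D := by linarith
  have hp0 : 0 < p := hL ▸ Real.exp_pos _
  have hC := one_le_covConst
  set X := D ^ c with hX
  set Y := D ^ (c - 1 / 2) with hY
  have hX0 : 0 < X := Real.rpow_pos_of_pos hD0 _
  have hY0 : 0 < Y := Real.rpow_pos_of_pos hD0 _
  have hXD : X / D ≤ Y ^ 2 := by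
    rw [hX, hY, ← Real.rpow_sub_one hD0.ne', ← Real.rpow_mul_natCast hD0.le]
    refine Real.rpow_le_rpow_of_exponent_le hD1 ?_
    push_cast
    linarith
  have hXXD : X * (X / D) = D ^ (2 * c - 1) := by
    rw [hX, ← Real.rpow_sub_one hD0.ne', ← Real.rpow_add hD0]
    ring_nf
  -- Bounding one factor of `L ^ 2` by `B * X` merges the two terms of the exponent into `e`. Since
  -- `e ≤ 1`, `exp e - 1 ≤ 2 e`, which is the choice of `δ`.
  set e := 16 * (2 * B + 1) * L * (X / D) with he
  have he0 : 0 ≤ e := by positivity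
  have he1 : e ≤ 1 := by
    refine le_trans ?_ hDB
    rw [← hXXD]
    calc e ≤ 16 * (2 * B + 1) * (B * X) * (X / D) := by rw [he]; gcongr
      _ = _ := by ring
  have hεe : 32 * L ^ 2 / D + 16 * L * X / D ≤ e := by
    calc 32 * L ^ 2 / D + 16 * L * X / D = 32 * L * L / D + 16 * L * X / D := by ring
      _ ≤ 32 * L * (B * X) / D + 16 * L * X / D := by gcongr
      _ = e := by rw [he]; ring
  set K := Real.sqrt (32 * (2 * B + 1)) with hK
  have hK0 : 0 ≤ K := Real.sqrt_nonneg _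
  have hsqrt : Real.sqrt e ≤ K * (L * Y) := by
    rw [hK, ← Real.sqrt_sq (by positivity : 0 ≤ L * Y), ← Real.sqrt_mul (by positivity)]
    refine Real.sqrt_le_sqrt ?_
    calc e ≤ 16 * (2 * B + 1) * L * Y ^ 2 := by rw [he]; gcongr
      _ ≤ 16 * (2 * B + 1) * (2 * L ^ 2) * Y ^ 2 := by gcongr; nlinarith
      _ = _ := by ring
  have hMY : D ^ (1 / 2 - c) = Y⁻¹ := by
    rw [hY, ← Real.rpow_neg hD0.le]
    ring_nf
  set M := D ^ (1 / 2 - c) / p ^ 2 with hM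
  have hM0 : 0 < M := by positivity
  have hlogM : 2 * L ≤ Real.log M := by
    rw [Real.le_log_iff_exp_le hM0, hM, le_div_iff₀ (by positivity), ← hL, ← Real.exp_nat_mul,
      ← Real.exp_add]
    refine le_trans (le_of_eq ?_) (Real.one_le_rpow hD1 (by linarith : 0 ≤ 1 / 2 - c))
    rw [Real.exp_eq_one_iff]
    push_cast
    ring
  have hlogM0 : 0 < Real.log M := by linarith
  have hA := thresholdConst_pos B
  have hU : accuracyThreshold (thresholdConst B) 3 c d p =
      thresholdConst B * M / Real.log M ^ 3 := by rw [accuracyThreshold, hD]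
  rw [hU]
  refine ⟨by positivity, 2 * e, ?_, ?_⟩
  · have h1 := Real.exp_le_exp.2 hεe
    have h2 := Real.abs_exp_sub_one_le (x := e) (by rwa [abs_of_nonneg he0])
    rw [abs_of_nonneg he0] at h2
    linarith [le_abs_self (Real.exp e - 1)]
  -- Here `384 = 64 * 6` collects the two numerical losses, `12 = 3 / 2 * 2 ^ 3` comes from `(2 L) ^
  -- 3`, and the `1` makes the inequality strict.
  · have h3 : 12 / thresholdConst B = 384 * covConst * K + 1 := by
      rw [thresholdConst, div_div_cancel₀ (by norm_num)]
    calc covConst * p ^ 2 * (1 + t) ^ 3 * (Real.sqrt (2 * (2 * e)) + 2 * (2 * e))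
        ≤ covConst * p ^ 2 * (64 * L ^ 2) * (6 * (K * (L * Y))) := by
          have h4 := one_add_pow_three_le ht hL12 htL
          have h5 := (sqrt_two_mul_add_two_mul_le he0 he1).trans
            (mul_le_mul_of_nonneg_left hsqrt (by norm_num))
          gcongr
      _ = 384 * covConst * K * (L ^ 3 * p ^ 2 * Y) := by ring
      _ < (384 * covConst * K + 1) * (L ^ 3 * p ^ 2 * Y) := by
          gcongr
          linarith
      _ = 3 / (2 * thresholdConst B) * ((2 * L) ^ 3 * p ^ 2 * Y) := by rw [← h3]; field_simp; ring
      _ ≤ 3 / (2 * thresholdConst B) * (Real.log M ^ 3 * p ^ 2 * Y) := by gcongr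
      _ = _ := by rw [hM, hMY]; field_simp

/-! ### The lower bounds -/

section LowerBounds

variable {d : ℕ} {t U b N : ℝ}

/-- Each query of accuracy less than `U` detects at most a fraction `b` of the noisy halfspaces at
distance `t` from the origin. -/
def HidesHalfspaces (d : ℕ) (t U b : ℝ) : Prop :=
  ∀ (q : StatQuery (Euc d × Bool)) (u : Set.Ioi (0 : ℝ)), (u : ℝ) < U →
    ((Finset.univ.filter fun v : Fin d → Bool =>
      hidingOracle (nullDist d (1 / 3) (gaussTail t)) (rcnDist (1 / 3) (signHalfspace t v)) q u ≠
        exactOracle (nullDist d (1 / 3) (gaussTail t)) q u).card : ℝ) ≤ b * 2 ^ d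

variable {Ω Out : Type*} [MeasurableSpace Ω] {P : Measure Ω}

/-- Almost surely, the algorithm returns the output for the null distribution on all but few of
the noisy halfspaces. -/
theorem ae_card_run_ne_le [DecidableEq Out] (hb : HidesHalfspaces d t U b) (hb0 : 0 ≤ b)
    {alg : Ω → SQAlgorithm (Euc d × Bool) Out} {𝒟 : Set (Measure (Euc d × Bool))}
    (h𝒟 : ∀ v : Fin d → Bool, rcnDist (1 / 3) (signHalfspace t v) ∈ 𝒟)
    (hacc : ¬ UsesAccuracy P alg 𝒟 U) (hnum : ¬ MakesQueries P alg 𝒟 N) (hN : 0 ≤ N) :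
    ∀ᵐ ω ∂P, ((Finset.univ.filter fun v : Fin d → Bool =>
      (alg ω).run (hidingOracle (nullDist d (1 / 3) (gaussTail t))
        (rcnDist (1 / 3) (signHalfspace t v))) ≠
      (alg ω).run (exactOracle (nullDist d (1 / 3) (gaussTail t)))).card : ℝ) ≤
        N * b * 2 ^ d := by
  have hae : ∀ v : Fin d → Bool, ∀ᵐ ω ∂P,
      (∀ u ∈ (alg ω).params (hidingOracle (nullDist d (1 / 3) (gaussTail t))
        (rcnDist (1 / 3) (signHalfspace t v))), u < U) ∧
      ((alg ω).params (hidingOracle (nullDist d (1 / 3) (gaussTail t))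
        (rcnDist (1 / 3) (signHalfspace t v)))).length ≤ ⌊N⌋₊ := by
    intro v
    have h1 : ¬ ∃ᵐ ω ∂P, ∃ u ∈ (alg ω).params (hidingOracle (nullDist d (1 / 3) (gaussTail t))
        (rcnDist (1 / 3) (signHalfspace t v))), U ≤ u := fun h =>
      hacc ⟨_, h𝒟 v, _, isVSTATOracle_hidingOracle _ _, h⟩
    have h2 : ¬ ∃ᵐ ω ∂P, N ≤ (((alg ω).params (hidingOracle (nullDist d (1 / 3) (gaussTail t))
        (rcnDist (1 / 3) (signHalfspace t v)))).length : ℝ) := fun h =>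
      hnum ⟨_, h𝒟 v, _, isVSTATOracle_hidingOracle _ _, h⟩
    rw [not_frequently] at h1 h2
    filter_upwards [h1, h2] with ω hω1 hω2
    refine ⟨fun u hu => not_le.1 fun hle => hω1 ⟨u, hu, hle⟩, Nat.le_floor (not_le.1 hω2).le⟩
  filter_upwards [ae_all_iff.2 hae] with ω hω
  have h := card_run_ne_le _ _ hb (by positivity) (alg ω) Finset.univ ⌊N⌋₊ fun v _ => hω v
  refine h.trans ?_
  rw [mul_assoc N]
  gcongr
  exact Nat.floor_le hN

theorem ofReal_le_measure_iff [IsProbabilityMeasure P] {S : Set Ω} {α : ℝ} :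
    ENNReal.ofReal α ≤ P S ↔ α ≤ P.real S :=
  ENNReal.ofReal_le_iff_le_toReal (measure_ne_top P S)

variable [IsProbabilityMeasure P]

theorem learning_lower_bound (hd : 0 < d) (ht : 0 ≤ t) (htp : gaussTail t ≤ 1 / 2)
    (hb : HidesHalfspaces d t U b) (hb0 : 0 ≤ b) (hN : 0 ≤ N) (hNb : N * b < 1 / 6)
    {alg : Ω → SQAlgorithm (Euc d × Bool) (Hypothesis d)}
    (halg : Learns P alg (1 / 3) (gaussTail t) (1 / 3 + gaussTail t / 3)) :
    UsesAccuracy P alg (biasedClass d (1 / 3) (gaussTail t)) U ∨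
      MakesQueries P alg (biasedClass d (1 / 3) (gaussTail t)) N := by
  classical
  by_contra! hcon
  have hae := ae_card_run_ne_le hb hb0 (rcnDist_mem_biasedClass hd htp) hcon.1 hcon.2 hN
  choose S hSm hSP hSgood using fun v : Fin d → Bool =>
    halg _ (rcnDist_mem_biasedClass hd htp v) _
      (isVSTATOracle_hidingOracle (nullDist d (1 / 3) (gaussTail t)) _)
  -- For a fixed seed, success requires that the hypothesis `h₀` produced on the null distribution
  -- is good, or that the run deviates from the null run. These account for the fractions `1 / 2`
  -- and `N * b`.
  have h := le_of_ae_card_le (P := P) hSm (α := 2 / 3) (β := 1 / 2 + N * b)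
    (fun v => ofReal_le_measure_iff.1 (hSP v)) (by
    filter_upwards [hae] with ω hω
    set h₀ := (alg ω).run (exactOracle (nullDist d (1 / 3) (gaussTail t)))
    have hG := two_mul_card_err_lt_le hd ht h₀
    have hsub : (Finset.univ.filter fun v => ω ∈ S v) ⊆
        (Finset.univ.filter fun v : Fin d → Bool =>
          err (rcnDist (1 / 3) (signHalfspace t v)) h₀ < 1 / 3 + gaussTail t / 3) ∪
        (Finset.univ.filter fun v : Fin d → Bool =>
          (alg ω).run (hidingOracle (nullDist d (1 / 3) (gaussTail t))
            (rcnDist (1 / 3) (signHalfspace t v))) ≠ h₀) := by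
      intro v hv
      have hv' := hSgood v ω (Finset.mem_filter.1 hv).2
      by_cases hr : (alg ω).run (hidingOracle (nullDist d (1 / 3) (gaussTail t))
            (rcnDist (1 / 3) (signHalfspace t v))) = h₀
      · rw [hr] at hv'
        exact Finset.mem_union_left _ (Finset.mem_filter.2 ⟨Finset.mem_univ _, hv'⟩)
      · exact Finset.mem_union_right _ (Finset.mem_filter.2 ⟨Finset.mem_univ _, hr⟩)
    have hle := (Finset.card_le_card hsub).trans (Finset.card_union_le _ _)
    have hle' := (Nat.cast_le (α := ℝ)).2 hle
    have hG' := (Nat.cast_le (α := ℝ)).2 hG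
    push_cast at hle' hG'
    simp only [Fintype.card_pi, Fintype.card_bool, Finset.prod_const, Finset.card_univ,
      Fintype.card_fin]
    push_cast
    linarith)
  linarith

theorem testing_lower_bound (hd : 0 < d) (hb : HidesHalfspaces d t U b) (hb0 : 0 ≤ b)
    (hN : 0 ≤ N) (hNb : N * b < 1 / 6) {alg : Ω → SQAlgorithm (Euc d × Bool) Bool}
    (halg : Tests P alg (1 / 3) (gaussTail t)) :
    UsesAccuracy P alg (testClass d (1 / 3) (gaussTail t)) U ∨
      MakesQueries P alg (testClass d (1 / 3) (gaussTail t)) N := by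
  classical
  by_contra! hcon
  have hmem : ∀ v : Fin d → Bool,
      rcnDist (1 / 3) (signHalfspace t v) ∈ testClass d (1 / 3) (gaussTail t) := fun v =>
    Set.mem_insert_of_mem _ (rcnDist_mem_posClass hd t v)
  have hae := ae_card_run_ne_le hb hb0 hmem hcon.1 hcon.2 hN
  choose S hSm hSP hSgood using fun v : Fin d → Bool =>
    halg _ (hmem v) _ (isVSTATOracle_hidingOracle (nullDist d (1 / 3) (gaussTail t)) _)
  obtain ⟨S₀, hS₀m, hS₀P, hS₀good⟩ := halg _ (Set.mem_insert _ _) _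
    (isVSTATOracle_exactOracle (nullDist d (1 / 3) (gaussTail t)))
  rw [ofReal_le_measure_iff] at hS₀P
  -- On this event the answers on the instance and on the null distribution are both correct, hence
  -- different, so the run must deviate. Two events of probability `2 / 3` overlap in at least `1 /
  -- 3`.
  have hinter : ∀ v, 1 / 3 ≤ P.real (S v ∩ S₀) := by
    intro v
    have h1 := ofReal_le_measure_iff.1 (hSP v)
    have h2 := measureReal_union_add_inter (μ := P) (s := S v) hS₀m
    have h3 : P.real (S v ∪ S₀) ≤ 1 := measureReal_le_one
    linarith
  have h := le_of_ae_card_le (P := P) (fun v => (hSm v).inter hS₀m) (β := N * b) hinter (by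
    filter_upwards [hae] with ω hω
    simp only [Fintype.card_pi, Fintype.card_bool, Finset.prod_const, Finset.card_univ,
      Fintype.card_fin]
    push_cast
    refine le_trans (Nat.cast_le.2 (Finset.card_le_card fun v hv => ?_)) hω
    have hv' := (Finset.mem_filter.1 hv).2
    refine Finset.mem_filter.2 ⟨Finset.mem_univ _, fun heq => ?_⟩
    have h1 := (hSgood v ω hv'.1).2 (rcnDist_mem_posClass hd t v)
    have h2 := (hS₀good ω hv'.2).1 rfl
    rw [heq, h2] at h1
    exact absurd h1 Bool.false_ne_true)
  linarith

end LowerBounds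

/-! ### Large dimension and conclusion -/

theorem eventually_dimension_large {c : ℝ} (hc0 : 0 < c) (hc : c < 1 / 2) (B : ℝ) :
    ∃ d₀ : ℕ, ∀ d : ℕ, d₀ ≤ d → 1 ≤ (d : ℝ) ∧ 6 ≤ (d : ℝ) ^ c ∧
      16 * (2 * B + 1) * B * (d : ℝ) ^ (2 * c - 1) ≤ 1 := by
  have hcast := tendsto_natCast_atTop_atTop (R := ℝ)
  have h1 := hcast.eventually_ge_atTop 1
  have h2 := ((tendsto_rpow_atTop hc0).comp hcast).eventually_ge_atTop 6
  have h3 : Tendsto (fun d : ℕ => 16 * (2 * B + 1) * B * (d : ℝ) ^ (2 * c - 1)) atTop (nhds 0) := by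
    have h4 := ((tendsto_rpow_neg_atTop (by linarith : 0 < 1 - 2 * c)).comp hcast).const_mul
      (16 * (2 * B + 1) * B)
    simpa [Function.comp_def] using h4
  have h5 := h3.eventually_le_const one_pos
  obtain ⟨d₀, hd₀⟩ := eventually_atTop.1 (h1.and (h2.and h5))
  exact ⟨d₀, hd₀⟩

/-- The number of queries times the fraction each detects is at most `2 exp (-X / 2)`, and `exp 3 >
12`. -/
theorem two_rpow_mul_exp_neg_lt {X : ℝ} (hX : 6 ≤ X) :
    (2 : ℝ) ^ (1 / 2 * X) * (2 * Real.exp (-X)) < 1 / 6 := by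
  have h1 : (2 : ℝ) ^ (1 / 2 * X) ≤ Real.exp (X / 2) := by
    rw [Real.rpow_def_of_pos two_pos, Real.exp_le_exp]
    have := Real.log_two_lt_d9
    nlinarith
  have h2 : (12 : ℝ) < Real.exp (X / 2) := by
    have h3 : Real.exp 3 ≤ Real.exp (X / 2) := Real.exp_le_exp.2 (by linarith)
    have h4 : Real.exp 3 = Real.exp 1 ^ 3 := by rw [← Real.exp_nat_mul]; norm_num
    have h5 : (2.7 : ℝ) ^ 3 ≤ Real.exp 1 ^ 3 :=
      pow_le_pow_left₀ (by norm_num) (by linarith [Real.exp_one_gt_d9]) 3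
    norm_num at h5
    linarith
  have h3 : Real.exp (-X) = (Real.exp (X / 2) * Real.exp (X / 2))⁻¹ := by
    rw [← Real.exp_add, ← Real.exp_neg]
    ring_nf
  set E := Real.exp (X / 2)
  calc (2 : ℝ) ^ (1 / 2 * X) * (2 * Real.exp (-X)) ≤ E * (2 * (E * E)⁻¹) := by rw [h3]; gcongr
    _ = 2 / E := by field_simp
    _ < 1 / 6 := by rw [div_lt_div_iff₀ (by linarith) (by norm_num)]; linarith

theorem theorem3p2 :
    ∃ k : ℕ, ∀ c : ℝ, 0 < c → c < 1 / 2 → ∀ B : ℝ, 0 < B →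
      ∃ A : ℝ, 0 < A ∧ ∃ κ : ℝ, 0 < κ ∧ ∃ d₀ : ℕ, ∀ d : ℕ, d₀ ≤ d →
        ∀ p : ℝ, (2 : ℝ) ^ (-(B * (d : ℝ) ^ c)) ≤ p → p ≤ 1 / 2 →
          ∀ (Ω : Type*) [MeasurableSpace Ω] (P : Measure Ω) [IsProbabilityMeasure P],
            (∀ alg : Ω → SQAlgorithm (Euc d × Bool) (Hypothesis d),
              Learns P alg (1 / 3) p (1 / 3 + p / 3) →
                UsesAccuracy P alg (biasedClass d (1 / 3) p) (accuracyThreshold A k c d p) ∨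
                MakesQueries P alg (biasedClass d (1 / 3) p) ((2 : ℝ) ^ (κ * (d : ℝ) ^ c))) ∧
            (∀ alg : Ω → SQAlgorithm (Euc d × Bool) Bool,
              Tests P alg (1 / 3) p →
                UsesAccuracy P alg (testClass d (1 / 3) p) (accuracyThreshold A k c d p) ∨
                MakesQueries P alg (testClass d (1 / 3) p) ((2 : ℝ) ^ (κ * (d : ℝ) ^ c))) := by
  refine ⟨3, fun c hc0 hc B hB => ?_⟩
  obtain ⟨d₀, hd₀⟩ := eventually_dimension_large hc0 hc B
  refine ⟨thresholdConst B, thresholdConst_pos B, 1 / 2, by norm_num, d₀,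
    fun d hd p hp hp2 Ω _ P _ => ?_⟩
  obtain ⟨hd1, hX, hDB⟩ := hd₀ d hd
  have hdpos : 0 < d := by
    have : (0 : ℝ) < d := by linarith
    exact_mod_cast this
  have hp0 : 0 < p := lt_of_lt_of_le (Real.rpow_pos_of_pos two_pos _) hp
  -- By continuity of the tail every admissible bias is attained exactly, so all the hard instances
  -- have bias exactly `p`.
  obtain ⟨t, ht, rfl⟩ := exists_gaussTail_eq hp0 hp2
  set L := -Real.log (gaussTail t) with hLdef
  have hL : Real.exp (-L) = gaussTail t := by rw [hLdef, neg_neg, Real.exp_log hp0]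
  have hL2 : Real.log 2 ≤ L := by
    have := Real.log_le_log hp0 hp2
    rw [one_div, Real.log_inv] at this
    linarith
  have hLB : L ≤ B * (d : ℝ) ^ c := by
    have h1 := Real.log_le_log (Real.rpow_pos_of_pos two_pos _) hp
    rw [Real.log_rpow two_pos] at h1
    have h2 : 0 < B * (d : ℝ) ^ c := by positivity
    have := Real.log_two_lt_d9
    nlinarith
  have htL : t ^ 2 ≤ 2 * L := by
    have := gaussTail_le_exp ht
    rw [← hL, Real.exp_le_exp] at this
    linarith
  obtain ⟨hU0, δ, hδ, hU⟩ :=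
    accuracyThreshold_bounds rfl hc0 hc hB hd1 hL hL2 hLB ht htL hDB
  have hhide : HidesHalfspaces d t (accuracyThreshold (thresholdConst B) 3 c d (gaussTail t))
      (2 * Real.exp (-(d : ℝ) ^ c)) :=
    card_hidingOracle_ne_le hdpos ht hL hL2 hδ hU0 hU
  have hb0 : 0 ≤ 2 * Real.exp (-(d : ℝ) ^ c) := by positivity
  have hN : (0 : ℝ) ≤ 2 ^ (1 / 2 * (d : ℝ) ^ c) := by positivity
  have hNb := two_rpow_mul_exp_neg_lt hX
  exact ⟨fun alg halg => learning_lower_bound hdpos ht hp2 hhide hb0 hN hNb halg,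
    fun alg halg => testing_lower_bound hdpos hhide hb0 hN hNb halg⟩

end
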